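/- The \emph{hexagonal grid} is the undirected graph with vertex set $\mathbb{Z}^2$ and edges $\{(x,y),(x+1,y)\}$ and $\{(x,y),(x,y+(-1)^{x+y})\}$ for all $(x,y)\in\mathbb{Z}^2$. An \emph{identifying code} on it is a set $C\subseteq\mathbb{Z}^2$ such that, writing $B_1(u)$ for the set consisting of $u$ and its neighbours, the sets $B_1(u)\cap C$ for $u\in\mathbb{Z}^2$ are nonempty and pairwise distinct. Let $T=\langle(0,2),(1,1)\rangle\leq\mathbb{Z}^2$, and let $\ell:\mathbb{Z}^2\to T$ be the isomorphism with $\ell(1,0)=(1,1)$ and $\ell(0,1)=(0,2)$. The \emph{density} of $C$ is $$\delta(C)=\lim_{n\to\infty}\frac{1}{2(2n+1)^2}\sum_{w\in[-n,n]^2}\bigl|C\cap\{\ell(w),\ell(w)+(1,0)\}\bigr|$$ whenever this limit exists. The code $C$ is \emph{$v$-periodic} if $C+v=C$. \textbf{Lemma 5.} For every nonzero $v\in T$, there is a least value $\alpha(v)$ among the densities of those $v$-periodic identifying codes on the hexagonal grid whose density exists. The number $\alpha(v)$ is rational, and it is exactly computable from $v$: there is a single algorithm that, given any nonzero $v\in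 T$, halts and outputs a numerator and a nonzero denominator of $\alpha(v)$. -/

import Mathlib

open Filter Topology

noncomputable section

/-- The closed ball of radius `r` around `u` in the path metric of `G`: the vertices that can be
reached from `u` along at most `r` edges. -/
def pathBall {V : Type*} (G : SimpleGraph V) (r : ℕ) (u : V) : Set V :=
  {w | ∃ p : G.Walk u w, p.length ≤ r}

/-- `C` is a radius-`r` identifying code on `G`: the sets `B_r(u) ∩ C` are nonempty and
pairwise distinct. -/
def IsIdentifyingCode {V : Type*} (G : SimpleGraph V) (r : ℕ) (C : Set V) : Prop :=
  (∀ u : V, (pathBall G r u ∩ C).Nonempty) ∧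
    ∀ u v : V, u ≠ v → pathBall G r u ∩ C ≠ pathBall G r v ∩ C

/-- The hexagonal grid: the undirected graph on `ℤ²` with the edges `{(x, y), (x + 1, y)}` and
`{(x, y), (x, y + (-1) ^ (x + y))}`. -/
def hexGrid : SimpleGraph (ℤ × ℤ) :=
  SimpleGraph.fromRel fun p q =>
    q = (p.1 + 1, p.2) ∨ q = (p.1, p.2 + ((p.1 + p.2).negOnePow : ℤ))

/-- The translation lattice `T = ⟨(0, 2), (1, 1)⟩` of the hexagonal grid. -/
def hexLattice : AddSubgroup (ℤ × ℤ) :=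
  AddSubgroup.closure {((0, 2) : ℤ × ℤ), ((1, 1) : ℤ × ℤ)}

/-- The isomorphism `ℓ` from `ℤ²` onto the translation lattice with `ℓ (1, 0) = (1, 1)` and
`ℓ (0, 1) = (0, 2)`. -/
def hexCoord (w : ℤ × ℤ) : ℤ × ℤ :=
  w.1 • ((1, 1) : ℤ × ℤ) + w.2 • ((0, 2) : ℤ × ℤ)

/-- The proportion of codewords among the two representatives `ℓ w`, `ℓ w + (1, 0)` of the vertex
orbits in the cell with index `w`. -/
def cellDensity (C : Set (ℤ × ℤ)) (w : ℤ × ℤ) : ℝ :=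
  (C.indicator 1 (hexCoord w) + C.indicator 1 (hexCoord w + (1, 0))) / 2

/-- The density of `C` exists and equals `δ`: the averages of the cell densities over the squares
`[-n, n]²` of cell indices converge to `δ`. -/
def HasCodeDensity (C : Set (ℤ × ℤ)) (δ : ℝ) : Prop :=
  Tendsto
    (fun n : ℕ =>
      (∑ w ∈ Finset.Icc (-(n : ℤ)) n ×ˢ Finset.Icc (-(n : ℤ)) n, cellDensity C w) /
        (2 * (n : ℝ) + 1) ^ 2)
    atTop (𝓝 δ)

/-- `C` is invariant under translation by `v`. -/
def IsPeriodicCode (v : ℤ × ℤ) (C : Set (ℤ × ℤ)) : Prop :=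
  ∀ u : ℤ × ℤ, u + v ∈ C ↔ u ∈ C

/-- The densities of the `v`-periodic (radius-`1`) identifying codes on the hexagonal grid, for
those codes whose density exists. -/
def periodicCodeDensities (v : ℤ × ℤ) : Set ℝ :=
  {δ | ∃ C : Set (ℤ × ℤ), IsIdentifyingCode hexGrid 1 C ∧ IsPeriodicCode v C ∧ HasCodeDensity C δ}

/-- The minimal density of a `v`-periodic identifying code on the hexagonal grid. -/
def minPeriodicDensity (v : ℤ × ℤ) : ℝ :=
  sInf (periodicCodeDensities v)

/-- `F` is rational on `L`, and some algorithm that is given `w ∈ L` halts and returns a numerator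
and a nonzero denominator of `F w`; on inputs outside `L` it may do anything. -/
def ExactlyComputableOn {α : Type*} [Primcodable α] (L : Set α) (F : α → ℝ) : Prop :=
  ∃ f : α →. ℤ × ℕ, Partrec f ∧
    ∀ w ∈ L, ∃ (p : ℤ) (q : ℕ), (p, q) ∈ f w ∧ q ≠ 0 ∧ F w = (p : ℝ) / (q : ℝ)

end

/-! Grouping the vertices into two-vertex cells indexed by `ℤ²` turns a code into a configuration
over a four-letter alphabet. Identification at a vertex depends only on codewords nearby, so
identifying codes are exactly the configurations obeying a local rule on 11 × 11 windows
(`isIdentifyingCode_iff_isAdmissible`).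

Fix a nonzero period `u` and cut the plane into strips parallel to `u`, thick enough that no window
reaches across a whole strip. Modulo `u`, two adjacent strips form a finite patch, so some pattern
recurs within a bounded number of strips. Repeating the strips between two recurrences forever gives
an admissible configuration with a second period, and its square period is bounded explicitly.
Deleting those strips leaves an admissible configuration. If `α` bounds from below the averages of
these biperiodic configurations, deleting cycles one at a time shows that `n` strips carry average
weight at least `α` per site, up to a deficit independent of `n` (`StripFrame.le_sum_slice`). Hence
every density is at least `α` (`StripFrame.le_of_hasAvg`).

So the minimum is attained among finitely many biperiodic configurations. These are coded by natural
numbers, optimality is a primitive recursive condition on the code, and an unbounded search finds an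
optimal code, whose density is a ratio of two computed integers. -/

/-! ### Averages over large squares and their invariance under translation. -/

/-- The average of `g` over the square `[-n, n]²`. -/
noncomputable def boxAvg (g : ℤ × ℤ → ℝ) (n : ℕ) : ℝ :=
  (∑ w ∈ Finset.Icc (-(n : ℤ)) n ×ˢ Finset.Icc (-(n : ℤ)) n, g w) / (2 * (n : ℝ) + 1) ^ 2

/-- The averages of `g` over the squares `[-n, n]²` converge to `δ`. -/
def HasAvg (g : ℤ × ℤ → ℝ) (δ : ℝ) : Prop :=
  Tendsto (boxAvg g) atTop (𝓝 δ)

lemma sum_Icc_neg_eq_sum_range {M : Type*} [AddCommMonoid M] (f : ℤ → M) (n : ℕ) :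
    ∑ x ∈ Finset.Icc (-(n : ℤ)) n, f x = ∑ i ∈ Finset.range (2 * n + 1), f (i - n) := by
  symm
  refine Finset.sum_bij (fun i _ => (i : ℤ) - n) ?_ ?_ ?_ ?_
  · intro i hi
    simp only [Finset.mem_range, Finset.mem_Icc] at *
    omega
  · intro i _ j _ h
    omega
  · intro x hx
    simp only [Finset.mem_Icc] at hx
    exact ⟨(x + n).toNat, by simp only [Finset.mem_range]; omega, by omega⟩
  · intros
    rfl

lemma sum_Icc_neg_succ_sub (f : ℤ → ℝ) (n : ℕ) :
    ∑ x ∈ Finset.Icc (-(n : ℤ)) n, (f (x + 1) - f x) = f (n + 1) - f (-n) := by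
  rw [sum_Icc_neg_eq_sum_range]
  have h := Finset.sum_range_sub (fun i : ℕ => f ((i : ℤ) - n)) (2 * n + 1)
  have e : ∀ i : ℕ, f (((i + 1 : ℕ) : ℤ) - n) = f ((i : ℤ) - n + 1) := fun i => by
    congr 1
    push_cast
    ring
  simp only [e] at h
  rw [h]
  congr 2
  · push_cast
    ring
  · push_cast
    ring

/-- Averages over `[-n, n]²` asymptotically ignore a translation by `s`. -/
def IsAvgShift (s : ℤ × ℤ) : Prop :=
  ∀ g : ℤ × ℤ → ℝ, (∃ B, ∀ w, |g w| ≤ B) →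
    Tendsto (fun n => boxAvg (fun w => g (w + s)) n - boxAvg g n) atTop (𝓝 0)

lemma tendsto_const_div_two_mul_add_one (B : ℝ) :
    Tendsto (fun n : ℕ => B / (2 * (n : ℝ) + 1)) atTop (𝓝 0) := by
  refine Tendsto.div_atTop tendsto_const_nhds ?_
  exact tendsto_atTop_add_const_right _ _
    (tendsto_natCast_atTop_atTop.const_mul_atTop (by norm_num))

lemma tendsto_zero_of_abs_le_boundary {u : ℕ → ℝ} {B : ℝ}
    (h : ∀ n, |u n| ≤ (2 * B) * (2 * (n : ℝ) + 1)) :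
    Tendsto (fun n : ℕ => u n / (2 * (n : ℝ) + 1) ^ 2) atTop (𝓝 0) := by
  refine squeeze_zero_norm (fun n => ?_) (tendsto_const_div_two_mul_add_one (2 * B))
  have hn : (0 : ℝ) < 2 * n + 1 := by positivity
  rw [Real.norm_eq_abs, abs_div, abs_of_pos (pow_pos hn 2), div_le_div_iff₀ (pow_pos hn 2) hn]
  calc |u n| * (2 * n + 1) ≤ (2 * B) * (2 * (n : ℝ) + 1) * (2 * n + 1) := by gcongr; exact h n
    _ = 2 * B * (2 * n + 1) ^ 2 := by ring

lemma card_Icc_neg (n : ℕ) : ((Finset.Icc (-(n : ℤ)) n).card : ℝ) = 2 * n + 1 := by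
  have : (Finset.Icc (-(n : ℤ)) n).card = 2 * n + 1 := by
    rw [Int.card_Icc]
    omega
  rw [this]
  push_cast
  ring

lemma abs_sum_Icc_neg_le {f : ℤ → ℝ} {B : ℝ} (h : ∀ y, |f y| ≤ B) (n : ℕ) :
    |∑ y ∈ Finset.Icc (-(n : ℤ)) n, f y| ≤ B * (2 * n + 1) := by
  refine (Finset.abs_sum_le_sum_abs _ _).trans ?_
  refine (Finset.sum_le_card_nsmul _ _ _ fun y _ => h y).trans ?_
  rw [nsmul_eq_mul, card_Icc_neg, mul_comm]

/-- Each row telescopes to its two end terms, at most `2 * B`; the `2n + 1` rows together are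
negligible against the area. -/
lemma isAvgShift_right : IsAvgShift (1, 0) := by
  rintro g ⟨B, hB⟩
  simp only [boxAvg, ← sub_div, ← Finset.sum_sub_distrib]
  refine tendsto_zero_of_abs_le_boundary (B := B) fun n => ?_
  rw [Finset.sum_product_right]
  refine abs_sum_Icc_neg_le (fun y => ?_) n
  have := sum_Icc_neg_succ_sub (fun x => g (x, y)) n
  simp only [Prod.mk_add_mk, add_zero]
  rw [this]
  exact (abs_sub _ _).trans (by linarith [hB ((n : ℤ) + 1, y), hB (-(n : ℤ), y)])

lemma isAvgShift_up : IsAvgShift (0, 1) := by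
  rintro g ⟨B, hB⟩
  simp only [boxAvg, ← sub_div, ← Finset.sum_sub_distrib]
  refine tendsto_zero_of_abs_le_boundary (B := B) fun n => ?_
  rw [Finset.sum_product]
  refine abs_sum_Icc_neg_le (fun x => ?_) n
  have := sum_Icc_neg_succ_sub (fun y => g (x, y)) n
  simp only [Prod.mk_add_mk, add_zero]
  rw [this]
  exact (abs_sub _ _).trans (by linarith [hB (x, (n : ℤ) + 1), hB (x, -(n : ℤ))])

lemma IsAvgShift.add {s t : ℤ × ℤ} (hs : IsAvgShift s) (ht : IsAvgShift t) :
    IsAvgShift (s + t) := by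
  rintro g ⟨B, hB⟩
  have h := (hs (fun w => g (w + t)) ⟨B, fun w => hB _⟩).add (ht g ⟨B, hB⟩)
  simpa [add_assoc] using h

lemma IsAvgShift.neg {s : ℤ × ℤ} (hs : IsAvgShift s) : IsAvgShift (-s) := by
  rintro g ⟨B, hB⟩
  have h := (hs (fun w => g (w + -s)) ⟨B, fun w => hB _⟩).neg
  simpa [add_assoc] using h

lemma isAvgShift_zero : IsAvgShift 0 := by
  rintro g -
  simp

lemma isAvgShift (s : ℤ × ℤ) : IsAvgShift s := by
  let S : AddSubgroup (ℤ × ℤ) :=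
    { carrier := {s | IsAvgShift s}
      add_mem' := fun hs ht => hs.add ht
      zero_mem' := isAvgShift_zero
      neg_mem' := fun hs => hs.neg }
  have h : s = s.1 • ((1, 0) : ℤ × ℤ) + s.2 • ((0, 1) : ℤ × ℤ) := by
    ext <;> simp
  rw [h]
  exact S.add_mem (S.zsmul_mem isAvgShift_right _) (S.zsmul_mem isAvgShift_up _)

lemma boxAvg_sum {ι : Type*} (I : Finset ι) (g : ι → ℤ × ℤ → ℝ) (n : ℕ) :
    boxAvg (fun w => ∑ i ∈ I, g i w) n = ∑ i ∈ I, boxAvg (g i) n := by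
  simp only [boxAvg]
  rw [Finset.sum_comm, Finset.sum_div]

lemma boxAvg_const (b : ℝ) (n : ℕ) : boxAvg (fun _ => b) n = b := by
  have hn : (0 : ℝ) < 2 * n + 1 := by positivity
  rw [boxAvg, Finset.sum_const, Finset.card_product, nsmul_eq_mul, Nat.cast_mul, card_Icc_neg]
  field_simp

lemma boxAvg_mono {f g : ℤ × ℤ → ℝ} (h : ∀ w, f w ≤ g w) (n : ℕ) : boxAvg f n ≤ boxAvg g n := by
  unfold boxAvg
  gcongr
  exact h _

lemma tendsto_boxAvg_sum_sub {g : ℤ × ℤ → ℝ} (hg : ∃ B, ∀ w, |g w| ≤ B) {ι : Type*}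
    (I : Finset ι) (s : ι → ℤ × ℤ) :
    Tendsto (fun n => boxAvg (fun w => ∑ i ∈ I, g (w + s i)) n - I.card * boxAvg g n)
      atTop (𝓝 0) := by
  have h := tendsto_finsetSum I fun i _ => isAvgShift (s i) g hg
  simp only [Finset.sum_const_zero, Finset.sum_sub_distrib, Finset.sum_const, nsmul_eq_mul] at h
  simpa only [boxAvg_sum] using h

/-- The sum of the translates has average `I.card * δ`. This turns a finite count valid at every
position into a bound on the density. -/
lemma HasAvg.le_of_sum_translates {g : ℤ × ℤ → ℝ} {δ : ℝ} (hδ : HasAvg g δ)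
    (hg : ∃ B, ∀ w, |g w| ≤ B) {ι : Type*} (I : Finset ι) (s : ι → ℤ × ℤ) {b : ℝ}
    (hb : ∀ w, b ≤ ∑ i ∈ I, g (w + s i)) : b ≤ I.card * δ := by
  have h := (tendsto_boxAvg_sum_sub hg I s).add (hδ.const_mul (I.card : ℝ))
  simp only [sub_add_cancel, zero_add] at h
  refine ge_of_tendsto' h fun n => ?_
  rw [← boxAvg_const b n]
  exact boxAvg_mono hb n

lemma hasAvg_of_sum_translates_eq {g : ℤ × ℤ → ℝ} (hg : ∃ B, ∀ w, |g w| ≤ B) {ι : Type*}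
    (I : Finset ι) (hI : I.Nonempty) (s : ι → ℤ × ℤ) {b : ℝ}
    (hb : ∀ w, ∑ i ∈ I, g (w + s i) = b) : HasAvg g (b / I.card) := by
  have hc : (I.card : ℝ) ≠ 0 := by
    exact_mod_cast hI.card_pos.ne'
  have h := ((tendsto_boxAvg_sum_sub hg I s).const_sub b).div_const (I.card : ℝ)
  simp only [hb, boxAvg_const, sub_sub_cancel, sub_zero] at h
  simp only [mul_div_cancel_left₀ _ hc] at h
  exact h

/-! ### Configurations obeying a local rule, and averages of biperiodic functions. -/

/-- The configuration `c` obeys the translation-invariant local rule `Q` on all `R × R` windows. -/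
def IsAdmissible {A : Type*} {R : ℕ} (Q : (Fin R → Fin R → A) → Prop) (c : ℤ × ℤ → A) : Prop :=
  ∀ w : ℤ × ℤ, Q fun i j => c (w + ((i : ℤ), (j : ℤ)))

section Admissible

variable {A : Type*} {R : ℕ} {Q : (Fin R → Fin R → A) → Prop} {c : ℤ × ℤ → A}

lemma IsAdmissible.shift (hc : IsAdmissible Q c) (s : ℤ × ℤ) :
    IsAdmissible Q fun w => c (w + s) := by
  intro w
  have := hc (w + s)
  simpa only [add_right_comm w s] using this

/-- The comparison configuration may vary with the window, which makes this the criterion for gluing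
pieces of admissible configurations. -/
lemma isAdmissible_of_locally
    (h : ∀ w : ℤ × ℤ, ∃ c' : ℤ × ℤ → A, IsAdmissible Q c' ∧
      ∀ i j : ℕ, i < R → j < R → c (w + ((i : ℤ), (j : ℤ))) = c' (w + ((i : ℤ), (j : ℤ)))) :
    IsAdmissible Q c := by
  intro w
  obtain ⟨c', h₁, h₂⟩ := h w
  have : (fun i j : Fin R => c (w + ((i : ℤ), (j : ℤ)))) =
      fun i j : Fin R => c' (w + ((i : ℤ), (j : ℤ))) := by
    funext i j
    exact h₂ i j i.2 j.2
  rw [this]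
  exact h₁ w

end Admissible

lemma sum_range_add_of_periodic {f : ℤ → ℝ} {N : ℕ} (hf : ∀ x, f (x + N) = f x) (a : ℤ) :
    ∑ i ∈ Finset.range N, f (a + i) = ∑ i ∈ Finset.range N, f i := by
  have step : ∀ b : ℤ, ∑ i ∈ Finset.range N, f (b + 1 + i) = ∑ i ∈ Finset.range N, f (b + i) := by
    intro b
    rw [← sub_eq_zero, ← Finset.sum_sub_distrib]
    have h := Finset.sum_range_sub (fun i : ℕ => f (b + i)) N
    simp only [Nat.cast_add, Nat.cast_one, Nat.cast_zero, add_zero, hf, sub_self] at h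
    rw [← h]
    refine Finset.sum_congr rfl fun i _ => ?_
    rw [add_assoc, add_comm (1 : ℤ)]
  induction a using Int.induction_on with
  | zero => simp
  | succ n ih => rw [step, ih]
  | pred n ih => rw [← ih, ← step, sub_add_cancel]

/-- The integer points of the square `[0, N)²`, indexed by pairs of natural numbers. -/
def squareIndices (N : ℕ) : Finset (ℕ × ℕ) :=
  Finset.range N ×ˢ Finset.range N

lemma card_squareIndices (N : ℕ) : (squareIndices N).card = N * N := by
  simp [squareIndices]

lemma sum_square_add_of_periodic {G : ℤ × ℤ → ℝ} {N : ℕ}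
    (h₁ : Function.Periodic G ((N : ℤ), 0)) (h₂ : Function.Periodic G (0, (N : ℤ))) (w : ℤ × ℤ) :
    ∑ f ∈ squareIndices N, G (w + ((f.1 : ℤ), (f.2 : ℤ))) =
      ∑ f ∈ squareIndices N, G ((f.1 : ℤ), (f.2 : ℤ)) := by
  have e₁ : ∀ y x : ℤ, G (x + N, y) = G (x, y) := fun y x => by simpa using h₁ (x, y)
  have e₂ : ∀ x y : ℤ, G (x, y + N) = G (x, y) := fun x y => by simpa using h₂ (x, y)
  obtain ⟨a, b⟩ := w
  simp only [squareIndices, Prod.mk_add_mk]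
  rw [Finset.sum_product, Finset.sum_product]
  simp only
  refine (Finset.sum_congr rfl fun i _ => sum_range_add_of_periodic
    (f := fun y => G (a + (i : ℕ), y)) (e₂ _) b).trans ?_
  rw [Finset.sum_comm, Finset.sum_comm (γ := ℕ) (f := fun x y : ℕ => G ((x : ℤ), (y : ℤ)))]
  exact Finset.sum_congr rfl fun j _ => sum_range_add_of_periodic (f := fun x => G (x, j)) (e₁ _) a

lemma hasAvg_of_biperiodic {g : ℤ × ℤ → ℝ} (hg : ∃ B, ∀ w, |g w| ≤ B) {N : ℕ} (hN : 0 < N)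
    (h₁ : Function.Periodic g ((N : ℤ), 0)) (h₂ : Function.Periodic g (0, (N : ℤ))) :
    HasAvg g ((∑ f ∈ squareIndices N, g ((f.1 : ℤ), (f.2 : ℤ))) / (N * N : ℕ)) := by
  rw [← card_squareIndices]
  refine hasAvg_of_sum_translates_eq hg _ ?_ (fun f => ((f.1 : ℤ), (f.2 : ℤ)))
    (sum_square_add_of_periodic h₁ h₂)
  rw [← Finset.card_pos, card_squareIndices]
  positivity

/-! ### Strips parallel to a period: splicing, repeating and deleting them. -/

/-- A slicing of the plane modulo `u` into strips of height `H` that are translates of each other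
by multiples of `τ`, and that `R × R` windows cannot cross; up to multiples of `u`, two adjacent
strips fit into the square `[-M, M]²`. -/
structure StripFrame (u : ℤ × ℤ) (R M : ℕ) where
  h : ℤ × ℤ →+ ℤ
  τ : ℤ × ℤ
  H : ℕ
  H_pos : 0 < H
  h_u : h u = 0
  h_τ : h τ = H
  abs_h_le : ∀ i j : ℕ, i < R → j < R → |h ((i : ℤ), (j : ℤ))| ≤ H
  right_mem : ∃ a b : ℤ, ((H : ℤ), 0) = a • u + b • τ
  up_mem : ∃ a b : ℤ, (0, (H : ℤ)) = a • u + b • τ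
  cover : ∀ w : ℤ × ℤ, |h w| ≤ H → ∃ t : ℤ, |(w + t • u).1| ≤ M ∧ |(w + t • u).2| ≤ M

namespace StripFrame

variable {u : ℤ × ℤ} {R M : ℕ} (F : StripFrame u R M)

lemma h_add_zsmul (w : ℤ × ℤ) (k : ℤ) : F.h (w + k • F.τ) = F.h w + k * F.H := by
  rw [map_add, map_zsmul, F.h_τ, smul_eq_mul]

lemma h_sub_zsmul (w : ℤ × ℤ) (k : ℤ) : F.h (w - k • F.τ) = F.h w - k * F.H := by
  rw [map_sub, map_zsmul, F.h_τ, smul_eq_mul]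

/-- The translate by a multiple of `τ` of `f` that lies in the strip number zero. -/
def reduce (f : ℤ × ℤ) : ℤ × ℤ :=
  f - (F.h f / F.H) • F.τ

lemma H_pos' : (0 : ℤ) < F.H := by exact_mod_cast F.H_pos

lemma h_reduce_nonneg (f : ℤ × ℤ) : 0 ≤ F.h (F.reduce f) := by
  rw [reduce, h_sub_zsmul]
  have := Int.ediv_mul_le (F.h f) F.H_pos'.ne'
  linarith

lemma h_reduce_lt (f : ℤ × ℤ) : F.h (F.reduce f) < F.H := by
  rw [reduce, h_sub_zsmul]
  have := Int.lt_ediv_add_one_mul_self (F.h f) F.H_pos'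
  linarith

/-- The sum of `g` over strip number `k`, where each class modulo `u` is counted with the same
multiplicity. -/
noncomputable def slice (g : ℤ × ℤ → ℝ) (k : ℤ) : ℝ :=
  ∑ f ∈ squareIndices F.H, g (F.reduce ((f.1 : ℤ), (f.2 : ℤ)) + k • F.τ)

variable {A : Type*} {Q : (Fin R → Fin R → A) → Prop} {c c₁ c₂ : ℤ × ℤ → A}

lemma slice_congr {g₁ g₂ : ℤ × ℤ → ℝ} {k : ℤ}
    (h : ∀ w, k * F.H ≤ F.h w → F.h w < (k + 1) * F.H → g₁ w = g₂ w) :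
    F.slice g₁ k = F.slice g₂ k := by
  refine Finset.sum_congr rfl fun f _ => h _ ?_ ?_
  · rw [h_add_zsmul]
    linarith [F.h_reduce_nonneg ((f.1 : ℤ), (f.2 : ℤ))]
  · rw [h_add_zsmul]
    linarith [F.h_reduce_lt ((f.1 : ℤ), (f.2 : ℤ))]

lemma slice_shift (g : ℤ × ℤ → ℝ) (k m : ℤ) :
    F.slice (fun w => g (w + m • F.τ)) k = F.slice g (k + m) := by
  simp only [slice, add_smul, add_assoc]

/-- Heights within a window differ from that of its corner by at most `H`. A window crossing the cut
therefore does so inside the band where `c₁` and `c₂` agree, so it is a window of the one chosen at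
its corner. -/
lemma isAdmissible_splice (h₁ : IsAdmissible Q c₁) (h₂ : IsAdmissible Q c₂) (a : ℤ)
    (h : ∀ w, a - F.H ≤ F.h w → F.h w < a + F.H → c₁ w = c₂ w) :
    IsAdmissible Q fun w => if F.h w < a then c₁ w else c₂ w := by
  refine isAdmissible_of_locally fun w => ?_
  have key : ∀ i j : ℕ, i < R → j < R → |F.h (w + ((i : ℤ), (j : ℤ))) - F.h w| ≤ F.H := by
    intro i j hi hj
    rw [map_add, add_sub_cancel_left]
    exact F.abs_h_le i j hi hj
  by_cases hw : F.h w < a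
  · refine ⟨c₁, h₁, fun i j hi hj => ?_⟩
    have := abs_le.1 (key i j hi hj)
    split_ifs with hx
    · rfl
    · exact (h _ (by linarith) (by linarith)).symm
  · refine ⟨c₂, h₂, fun i j hi hj => ?_⟩
    have := abs_le.1 (key i j hi hj)
    split_ifs with hx
    · exact h _ (by linarith) (by linarith)
    · rfl

/-- The configuration that repeats the strips `i, …, j - 1` of `c`. -/
def cycleConfig (c : ℤ × ℤ → A) (i : ℤ) (L : ℤ) (w : ℤ × ℤ) : A :=
  c (w - ((F.h w - i * F.H) / (L * F.H) * L) • F.τ)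

lemma cycleConfig_periodic (hu : Function.Periodic c u) (i L : ℤ) :
    Function.Periodic (F.cycleConfig c i L) u := by
  intro w
  simp only [cycleConfig, map_add, F.h_u, add_zero]
  rw [add_sub_right_comm, hu]

lemma cycleConfig_periodic_tau (c : ℤ × ℤ → A) (i : ℤ) {L : ℤ} (hL : 0 < L) :
    Function.Periodic (F.cycleConfig c i L) (L • F.τ) := by
  intro w
  have hLH : L * F.H ≠ 0 := (mul_pos hL F.H_pos').ne'
  have e : (F.h (w + L • F.τ) - i * F.H) / (L * F.H) = (F.h w - i * F.H) / (L * F.H) + 1 := by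
    rw [h_add_zsmul, add_sub_right_comm, Int.add_ediv_of_dvd_right (dvd_refl _),
      Int.ediv_self hLH]
  simp only [cycleConfig, e, add_mul, one_mul, add_smul]
  congr 1
  abel

lemma cycleConfig_eq (c : ℤ × ℤ → A) (i L : ℤ) {w : ℤ × ℤ}
    (h₁ : i * F.H ≤ F.h w) (h₂ : F.h w < (i + L) * F.H) : F.cycleConfig c i L w = c w := by
  have : (F.h w - i * F.H) / (L * F.H) = 0 := Int.ediv_eq_zero_of_lt (by linarith) (by linarith)
  simp [cycleConfig, this]

/-- At each junction the end of one copy meets the start of the next; since `c` looks the same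
around the cuts `i` and `j`, the junction looks like a place in `c` itself. -/
lemma isAdmissible_cycleConfig (hc : IsAdmissible Q c) {i j : ℤ} (hij : i < j)
    (h : ∀ w, -(F.H : ℤ) ≤ F.h w → F.h w < F.H → c (w + i • F.τ) = c (w + j • F.τ)) :
    IsAdmissible Q (F.cycleConfig c i (j - i)) := by
  refine isAdmissible_of_locally fun w => ?_
  have hH := F.H_pos'
  have hL : 1 ≤ j - i := by linarith
  obtain ⟨L, hLdef⟩ : ∃ L, L = j - i := ⟨_, rfl⟩
  rw [← hLdef] at hL ⊢
  have hj : j = i + L := by rw [hLdef]; ring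
  have hLH : (F.H : ℤ) ≤ L * F.H := by nlinarith
  have hLH' : 0 < L * F.H := by linarith
  obtain ⟨t, ht⟩ : ∃ t, t = (F.h w - i * F.H) / (L * F.H) := ⟨_, rfl⟩
  have lo : ∀ x : ℤ, x / (L * F.H) * (L * F.H) ≤ x := fun x => Int.ediv_mul_le x hLH'.ne'
  have hi : ∀ x : ℤ, x < (x / (L * F.H) + 1) * (L * F.H) := fun x =>
    Int.lt_ediv_add_one_mul_self x hLH'
  -- Compare with the translate of `c` that fills copy number `t`, the one containing the corner
  -- `w`.
  refine ⟨fun x => c (x + (-(t * L)) • F.τ), hc.shift _, fun a b ha hb => ?_⟩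
  generalize hx : w + ((a : ℤ), (b : ℤ)) = x
  have hwx : |F.h x - F.h w| ≤ F.H := by
    rw [← hx, map_add, add_sub_cancel_left]
    exact F.abs_h_le a b ha hb
  obtain ⟨d₁, d₂⟩ := abs_le.1 hwx
  simp only [cycleConfig]
  obtain ⟨s, hs⟩ : ∃ s, s = (F.h x - i * F.H) / (L * F.H) := ⟨_, rfl⟩
  have b₁ := lo (F.h w - i * F.H)
  have b₂ := hi (F.h w - i * F.H)
  have b₃ := lo (F.h x - i * F.H)
  have b₄ := hi (F.h x - i * F.H)
  rw [← ht] at b₁ b₂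
  rw [← hs] at b₃ b₄ ⊢
  -- A window is no higher than one copy, so the copy number `s` of `x` differs from `t` by at most
  -- one.
  have s₁ : s < t + 2 := by
    by_contra hcon
    push Not at hcon
    nlinarith
  have s₂ : t < s + 2 := by
    by_contra hcon
    push Not at hcon
    nlinarith
  have : s = t ∨ s = t + 1 ∨ s = t - 1 := by omega
  rcases this with rfl | rfl | rfl
  · rw [neg_smul, sub_eq_add_neg]
  -- Here `x` lies just above the top of copy `t`; shifting that top, the cut `j`, to height zero
  -- brings `x` into the band of `h`. The next case uses the cut `i` at the bottom of the copy in
  -- the same way.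
  · have := h (x + (-(t * L + j)) • F.τ) (by rw [h_add_zsmul]; subst hj; nlinarith)
      (by rw [h_add_zsmul]; subst hj; nlinarith)
    rw [add_assoc, add_assoc, ← add_smul, ← add_smul] at this
    rw [sub_eq_add_neg, ← neg_smul]
    convert this using 4
    · rw [hj]; ring
    · ring
  · have := h (x + (-(t * L + i)) • F.τ) (by rw [h_add_zsmul]; subst hj; nlinarith)
      (by rw [h_add_zsmul]; subst hj; nlinarith)
    rw [add_assoc, add_assoc, ← add_smul, ← add_smul] at this
    rw [sub_eq_add_neg, ← neg_smul]
    convert this.symm using 4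
    · rw [hj]; ring
    · ring

/-- The configuration obtained from `c` by removing the strips `i, …, j - 1`. -/
def removeCycle (c : ℤ × ℤ → A) (i j : ℤ) (w : ℤ × ℤ) : A :=
  if F.h w < i * F.H then c w else c (w + (j - i) • F.τ)

lemma isAdmissible_removeCycle (hc : IsAdmissible Q c) {i j : ℤ}
    (h : ∀ w, -(F.H : ℤ) ≤ F.h w → F.h w < F.H → c (w + i • F.τ) = c (w + j • F.τ)) :
    IsAdmissible Q (F.removeCycle c i j) := by
  refine F.isAdmissible_splice hc (hc.shift _) _ fun w h₁ h₂ => ?_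
  have := h (w - i • F.τ) (by rw [h_sub_zsmul]; linarith) (by rw [h_sub_zsmul]; linarith)
  rw [sub_add_cancel, sub_add_eq_add_sub, ← add_sub, ← sub_smul] at this
  exact this

lemma removeCycle_periodic (hu : Function.Periodic c u) (i j : ℤ) :
    Function.Periodic (F.removeCycle c i j) u := by
  intro w
  simp only [removeCycle, map_add, F.h_u, add_zero]
  rw [hu, add_right_comm, hu]

lemma slice_removeCycle_of_lt (c : ℤ × ℤ → A) (wt : A → ℝ) {i j k : ℤ} (hk : k < i) :
    F.slice (fun w => wt (F.removeCycle c i j w)) k = F.slice (fun w => wt (c w)) k := by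
  refine F.slice_congr fun w _ h₂ => ?_
  have : (k + 1) * F.H ≤ i * F.H := mul_le_mul_of_nonneg_right hk F.H_pos'.le
  rw [removeCycle, if_pos (h₂.trans_le this)]

lemma slice_removeCycle_of_le (c : ℤ × ℤ → A) (wt : A → ℝ) {i j k : ℤ} (hk : i ≤ k) :
    F.slice (fun w => wt (F.removeCycle c i j w)) k =
      F.slice (fun w => wt (c w)) (k + (j - i)) := by
  rw [← slice_shift]
  refine F.slice_congr fun w h₁ _ => ?_
  have : i * F.H ≤ k * F.H := mul_le_mul_of_nonneg_right hk F.H_pos'.le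
  rw [removeCycle, if_neg (by linarith)]

/-- Bookkeeping for the induction: the first `n` strips consist of the shortened configuration and
the deleted cycle. -/
lemma sum_slice_removeCycle (c : ℤ × ℤ → A) (wt : A → ℝ) {i j n : ℕ} (hij : i ≤ j) (hn : j ≤ n) :
    ∑ k ∈ Finset.range n, F.slice (fun w => wt (c w)) k =
      ∑ k ∈ Finset.range (n - (j - i)), F.slice (fun w => wt (F.removeCycle c i j w)) k +
        ∑ k ∈ Finset.range (j - i), F.slice (fun w => wt (c w)) (i + k) := by
  obtain ⟨m, rfl⟩ := Nat.exists_eq_add_of_le hij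
  obtain ⟨l, rfl⟩ := Nat.exists_eq_add_of_le hn
  have e₁ : i + m - i = m := by omega
  have e₂ : i + m + l - m = i + l := by omega
  rw [e₁, e₂, Finset.sum_range_add, Finset.sum_range_add, Finset.sum_range_add]
  have a₁ : ∑ k ∈ Finset.range i, F.slice (fun w => wt (F.removeCycle c i ↑(i + m) w)) k =
      ∑ k ∈ Finset.range i, F.slice (fun w => wt (c w)) k :=
    Finset.sum_congr rfl fun k hk =>
      F.slice_removeCycle_of_lt c wt (by exact_mod_cast Finset.mem_range.1 hk)
  have a₂ : ∑ k ∈ Finset.range l, F.slice (fun w => wt (F.removeCycle c i ↑(i + m) w)) ↑(i + k) =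
      ∑ k ∈ Finset.range l, F.slice (fun w => wt (c w)) ↑(i + m + k) :=
    Finset.sum_congr rfl fun k _ => by
      rw [F.slice_removeCycle_of_le c wt (by push_cast; linarith)]
      congr 1
      push_cast
      ring
  rw [a₁, a₂]
  push_cast
  ring

end StripFrame

/-! ### Recurring strips and the lower bound for all periodic configurations. -/

namespace StripFrame

variable {u : ℤ × ℤ} {R M : ℕ} (F : StripFrame u R M)
variable {A : Type*} {Q : (Fin R → Fin R → A) → Prop} {c : ℤ × ℤ → A}

lemma periodic_of_mem {B : Type*} {g : ℤ × ℤ → B} {s t z : ℤ × ℤ} (hs : Function.Periodic g s)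
    (ht : Function.Periodic g t) (hz : ∃ a b : ℤ, z = a • s + b • t) : Function.Periodic g z := by
  obtain ⟨a, b, rfl⟩ := hz
  exact (hs.zsmul a).add_period (ht.zsmul b)

/-- Scaling `right_mem` by `L` expresses the horizontal vector through `u` and `L • τ`. A closed-up
cycle thereby acquires a square period, as the encoding by numbers requires. -/
lemma periodic_right {B : Type*} {g : ℤ × ℤ → B} {L : ℕ} (hu : Function.Periodic g u)
    (hτ : Function.Periodic g ((L : ℤ) • F.τ)) :
    Function.Periodic g (((L * F.H : ℕ) : ℤ), 0) := by
  obtain ⟨a, b, h⟩ := F.right_mem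
  refine periodic_of_mem hu hτ ⟨L * a, b, ?_⟩
  have := congrArg (fun z => (L : ℤ) • z) h
  simp only [smul_add, smul_smul, Prod.smul_mk, smul_eq_mul, mul_zero] at this
  rw [Nat.cast_mul, this, smul_smul, mul_comm b]

lemma periodic_up {B : Type*} {g : ℤ × ℤ → B} {L : ℕ} (hu : Function.Periodic g u)
    (hτ : Function.Periodic g ((L : ℤ) • F.τ)) :
    Function.Periodic g (0, ((L * F.H : ℕ) : ℤ)) := by
  obtain ⟨a, b, h⟩ := F.up_mem
  refine periodic_of_mem hu hτ ⟨L * a, b, ?_⟩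
  have := congrArg (fun z => (L : ℤ) • z) h
  simp only [smul_add, smul_smul, Prod.smul_mk, smul_eq_mul, mul_zero] at this
  rw [Nat.cast_mul, this, smul_smul, mul_comm b]

lemma hasAvg_of_periodic {g : ℤ × ℤ → ℝ} (hg : ∃ B, ∀ w, |g w| ≤ B) {L : ℕ} (hL : 0 < L)
    (hu : Function.Periodic g u) (hτ : Function.Periodic g ((L : ℤ) • F.τ)) (i : ℤ) :
    HasAvg g ((∑ k ∈ Finset.range L, F.slice g (i + k)) / (L * (F.H * F.H) : ℕ)) := by
  -- Summing `L` successive translates improves the period `L • τ` to `τ`. Then `G` has square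
  -- period `H`, and its sum over a square can be moved into strips by `reduce`.
  set G : ℤ × ℤ → ℝ := fun w => ∑ k ∈ Finset.range L, g (w + (k : ℤ) • F.τ) with hG
  have Gu : Function.Periodic G u := fun w => by
    simp only [hG, add_right_comm w u, hu _]
  have Gτ : Function.Periodic G F.τ := fun w => by
    have := sum_range_add_of_periodic (f := fun x : ℤ => g (w + x • F.τ)) (N := L)
      (fun x => by rw [add_smul, ← add_assoc, hτ]) 1
    simpa only [hG, add_smul, one_smul, add_assoc] using this
  have Gτ' : ∀ w (k : ℤ), G (w + k • F.τ) = G w := fun w k => Gτ.zsmul k w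
  have Gred : ∀ f, G (F.reduce f) = G f := fun f => by
    rw [reduce, sub_eq_add_neg, ← neg_smul, Gτ']
  have h₁ : Function.Periodic G ((F.H : ℤ), 0) := periodic_of_mem Gu Gτ F.right_mem
  have h₂ : Function.Periodic G (0, (F.H : ℤ)) := periodic_of_mem Gu Gτ F.up_mem
  have hs : ∑ k ∈ Finset.range L, F.slice g (i + k) =
      ∑ f ∈ squareIndices F.H, G ((f.1 : ℤ), (f.2 : ℤ)) := by
    simp only [slice]
    rw [Finset.sum_comm]
    refine Finset.sum_congr rfl fun f _ => ?_
    rw [← Gred, ← Gτ' _ i]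
    simp only [hG, add_smul, add_assoc]
  have hcard : (Finset.range L ×ˢ squareIndices F.H).card = L * (F.H * F.H) := by
    rw [Finset.card_product, Finset.card_range, card_squareIndices]
  rw [hs, ← hcard]
  refine hasAvg_of_sum_translates_eq hg _ ?_
    (fun x => ((x.2.1 : ℤ), (x.2.2 : ℤ)) + (x.1 : ℤ) • F.τ) fun w => ?_
  · have := F.H_pos
    rw [← Finset.card_pos, hcard]
    positivity
  · rw [← sum_square_add_of_periodic h₁ h₂ w, Finset.sum_product, Finset.sum_comm]
    simp only [hG, add_assoc]

/-- The number of patterns on the square `[-M, M]²`. -/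
def patchCount (A : Type*) [Fintype A] (M : ℕ) : ℕ :=
  Fintype.card A ^ ((2 * M + 1) * (2 * M + 1))

/-- By `cover`, periodicity under `u` determines a double strip from one patch; pigeonhole applies
to `patchCount A M + 1` patches. -/
lemma exists_repeated_strip [Fintype A] (hu : Function.Periodic c u) :
    ∃ i j : ℕ, i < j ∧ j ≤ patchCount A M ∧ ∀ w, -(F.H : ℤ) ≤ F.h w → F.h w < F.H →
      c (w + (i : ℤ) • F.τ) = c (w + (j : ℤ) • F.τ) := by
  classical
  let patch : Fin (patchCount A M + 1) → (Fin (2 * M + 1) × Fin (2 * M + 1) → A) :=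
    fun k x => c (((x.1 : ℤ) - M, (x.2 : ℤ) - M) + ((k : ℕ) : ℤ) • F.τ)
  have key : ∀ i j, patch i = patch j → ∀ w, -(F.H : ℤ) ≤ F.h w → F.h w < F.H →
      c (w + ((i : ℕ) : ℤ) • F.τ) = c (w + ((j : ℕ) : ℤ) • F.τ) := by
    intro i j hij w h₁ h₂
    obtain ⟨t, ht₁, ht₂⟩ := F.cover w (abs_le.2 ⟨h₁, h₂.le⟩)
    rw [abs_le] at ht₁ ht₂
    have e : ∀ k : Fin (patchCount A M + 1), c (w + ((k : ℕ) : ℤ) • F.τ) = patch k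
        (⟨((w + t • u).1 + M).toNat, by omega⟩, ⟨((w + t • u).2 + M).toNat, by omega⟩) := by
      intro k
      rw [← hu.zsmul t (w + ((k : ℕ) : ℤ) • F.τ), add_right_comm]
      simp only [patch]
      congr 2
      ext
      · simp only
        omega
      · simp only
        omega
    rw [e, e, hij]
  obtain ⟨i, j, hne, hij⟩ := Fintype.exists_ne_map_eq_of_card_lt patch (by
    rw [Fintype.card_fun, Fintype.card_prod, Fintype.card_fin, Fintype.card_fin]
    exact Nat.lt_succ_self _)
  rcases lt_or_gt_of_ne hne with h | h
  · exact ⟨i, j, h, by omega, key i j hij⟩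
  · exact ⟨j, i, h, by omega, key j i hij.symm⟩

variable [Fintype A] {wt : A → ℝ} {α : ℝ}

lemma exists_abs_comp_le (wt : A → ℝ) (c : ℤ × ℤ → A) : ∃ B, ∀ w, |wt (c w)| ≤ B := by
  obtain ⟨B, hB⟩ := (Set.finite_range fun a => |wt a|).bddAbove
  exact ⟨B, fun w => hB ⟨c w, rfl⟩⟩

/-- `α` is a lower bound for the averages of the admissible `u`-periodic configurations that have
a square period of side at most `B`. -/
def IsBiperiodicLowerBound (Q : (Fin R → Fin R → A) → Prop) (u : ℤ × ℤ) (B : ℕ) (wt : A → ℝ)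
    (α : ℝ) : Prop :=
  ∀ c : ℤ × ℤ → A, IsAdmissible Q c → Function.Periodic c u → ∀ N : ℕ, 0 < N → N ≤ B →
    Function.Periodic c ((N : ℤ), 0) → Function.Periodic c (0, (N : ℤ)) →
      ∀ δ, HasAvg (fun w => wt (c w)) δ → α ≤ δ

/-- Closing the cycle up gives a biperiodic configuration of period `L * H ≤ B`, whose average is
that of the `L` strips; the assumed bound applies to it. -/
lemma le_sum_slice_of_cycle {B : ℕ} (hB : patchCount A M * F.H ≤ B)
    (hα : IsBiperiodicLowerBound Q u B wt α) (hc : IsAdmissible Q c)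
    (hu : Function.Periodic c u) {i L : ℕ} (hL : 0 < L) (hLB : L ≤ patchCount A M)
    (h : ∀ w, -(F.H : ℤ) ≤ F.h w → F.h w < F.H →
      c (w + (i : ℤ) • F.τ) = c (w + ((i : ℤ) + L) • F.τ)) :
    α * (F.H * F.H) * L ≤ ∑ k ∈ Finset.range L, F.slice (fun w => wt (c w)) (i + k) := by
  have hL' : (0 : ℤ) < L := by exact_mod_cast hL
  set d := F.cycleConfig c i L with hd
  have dadm : IsAdmissible Q d := by
    have := F.isAdmissible_cycleConfig hc (lt_add_of_pos_right (i : ℤ) hL') h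
    rwa [add_sub_cancel_left] at this
  have du : Function.Periodic d u := F.cycleConfig_periodic hu i L
  have dτ : Function.Periodic d ((L : ℤ) • F.τ) := F.cycleConfig_periodic_tau c i hL'
  have havg := F.hasAvg_of_periodic (exists_abs_comp_le wt d) hL (du.comp wt) (dτ.comp wt) i
  have hle := hα d dadm du (L * F.H) (Nat.mul_pos hL F.H_pos)
    ((Nat.mul_le_mul_right _ hLB).trans hB) (F.periodic_right du dτ) (F.periodic_up du dτ) _ havg
  have hs : ∑ k ∈ Finset.range L, F.slice (fun w => wt (d w)) (i + k) =
      ∑ k ∈ Finset.range L, F.slice (fun w => wt (c w)) (i + k) := by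
    refine Finset.sum_congr rfl fun k hk => F.slice_congr fun w h₁ h₂ => ?_
    have hk' : (k : ℤ) + 1 ≤ L := by exact_mod_cast Finset.mem_range.1 hk
    have hH := F.H_pos'
    rw [hd, F.cycleConfig_eq c i L]
    · have : (0 : ℤ) ≤ k * F.H := by positivity
      linarith
    · have : ((i : ℤ) + k + 1) * F.H ≤ (i + L) * F.H :=
        mul_le_mul_of_nonneg_right (by linarith) hH.le
      linarith
  have hpos : (0 : ℝ) < (L * (F.H * F.H) : ℕ) := by
    have := F.H_pos
    exact_mod_cast Nat.mul_pos hL (Nat.mul_pos this this)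
  rw [hs, le_div_iff₀ hpos] at hle
  push_cast at hle
  linarith

/-- Strong induction on the number of strips: delete a cycle, which carries at least its share `α *
H²` per strip. -/
lemma le_sum_slice {B : ℕ} (hB : patchCount A M * F.H ≤ B)
    (hα : IsBiperiodicLowerBound Q u B wt α) (hα₀ : 0 ≤ α) (hwt : ∀ a, 0 ≤ wt a) (n : ℕ) :
    ∀ c : ℤ × ℤ → A, IsAdmissible Q c → Function.Periodic c u →
      α * (F.H * F.H) * ((n : ℝ) - patchCount A M) ≤
        ∑ k ∈ Finset.range n, F.slice (fun w => wt (c w)) k := by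
  induction n using Nat.strong_induction_on with
  | _ n ih =>
    intro c hc hu
    have hH : 0 ≤ α * ((F.H : ℝ) * F.H) := by positivity
    -- With too few strips to force a recurrence, the left side is nonpositive and the weight
    -- nonnegative; this accounts for the deficit `patchCount A M`.
    rcases lt_or_ge n (patchCount A M) with hn | hn
    · have : (n : ℝ) ≤ patchCount A M := by exact_mod_cast hn.le
      refine (mul_nonpos_of_nonneg_of_nonpos hH (by linarith)).trans ?_
      exact Finset.sum_nonneg fun k _ => Finset.sum_nonneg fun f _ => hwt _
    · obtain ⟨i, j, hij, hj, h⟩ := F.exists_repeated_strip hu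
      obtain ⟨L, rfl⟩ := Nat.exists_eq_add_of_lt hij
      have h' : ∀ w, -(F.H : ℤ) ≤ F.h w → F.h w < F.H →
          c (w + (i : ℤ) • F.τ) = c (w + ((i : ℤ) + (L + 1 : ℕ)) • F.τ) := by
        intro w h₁ h₂
        rw [h w h₁ h₂]
        push_cast
        simp only [add_assoc]
      have hcyc := F.le_sum_slice_of_cycle hB hα hc hu (Nat.succ_pos L) (by omega) h'
      rw [F.sum_slice_removeCycle c wt hij.le (hj.trans hn)]
      have e : i + L + 1 - i = L + 1 := by omega
      rw [e]
      have hrec := ih (n - (L + 1)) (by omega) (F.removeCycle c i (i + L + 1 : ℕ))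
        (F.isAdmissible_removeCycle hc h) (F.removeCycle_periodic hu _ _)
      rw [Nat.cast_sub (by omega)] at hrec
      push_cast at hrec hcyc ⊢
      linarith

lemma le_of_hasAvg {B : ℕ} (hB : patchCount A M * F.H ≤ B)
    (hα : IsBiperiodicLowerBound Q u B wt α) (hα₀ : 0 ≤ α) (hwt : ∀ a, 0 ≤ wt a)
    (hc : IsAdmissible Q c) (hu : Function.Periodic c u) {δ : ℝ}
    (hδ : HasAvg (fun w => wt (c w)) δ) : α ≤ δ := by
  have key : ∀ n : ℕ, α * ((n : ℝ) - patchCount A M) ≤ n * δ := by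
    intro n
    have h := hδ.le_of_sum_translates (exists_abs_comp_le wt c)
      (Finset.range n ×ˢ squareIndices F.H)
      (fun x => F.reduce ((x.2.1 : ℤ), (x.2.2 : ℤ)) + (x.1 : ℤ) • F.τ)
      (b := α * (F.H * F.H) * ((n : ℝ) - patchCount A M)) fun w => by
        have hw := F.le_sum_slice hB hα hα₀ hwt n (fun x => c (x + w)) (hc.shift w) (fun x => by
          change c (x + u + w) = c (x + w)
          rw [add_right_comm, hu])
        refine hw.trans_eq ?_
        rw [Finset.sum_product]
        refine Finset.sum_congr rfl fun k _ => Finset.sum_congr rfl fun f _ => ?_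
        rw [add_comm w]
    rw [Finset.card_product, Finset.card_range, card_squareIndices] at h
    push_cast at h
    have hH : (0 : ℝ) < F.H := by exact_mod_cast F.H_pos
    have hHH : (0 : ℝ) < (F.H : ℝ) * F.H := by positivity
    refine le_of_mul_le_mul_right ?_ hHH
    linarith
  by_contra hcon
  push Not at hcon
  -- If `δ < α`, the constant deficit is beaten once `n * (α - δ)` exceeds `α * patchCount A M`.
  obtain ⟨n, hn⟩ := exists_nat_gt (α * patchCount A M / (α - δ))
  rw [div_lt_iff₀ (by linarith)] at hn
  linarith [key n]

end StripFrame

/-! ### The strips for a given nonzero period. -/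

/-- The strip frame for `u = (p, q)` given by the determinant against `u`. -/
def stripFrame (u : ℤ × ℤ) (hu : u ≠ 0) (R : ℕ) (hR : 0 < R) :
    StripFrame u R (R * (u.1.natAbs + u.2.natAbs)) where
  h := AddMonoidHom.mk' (fun w => u.1 * w.2 - u.2 * w.1) fun a b => by
    simp only [Prod.fst_add, Prod.snd_add]
    ring
  τ := (-(R * u.2), R * u.1)
  H := R * (u.1.natAbs ^ 2 + u.2.natAbs ^ 2)
  H_pos := by
    refine Nat.mul_pos hR ?_
    rcases eq_or_ne u.1 0 with h | h
    · have h₂ : u.2 ≠ 0 := fun h₂ => hu (Prod.ext h h₂)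
      have := Int.natAbs_pos.2 h₂
      positivity
    · have := Int.natAbs_pos.2 h
      positivity
  h_u := by
    simp only [AddMonoidHom.mk'_apply]
    ring
  h_τ := by
    simp only [AddMonoidHom.mk'_apply]
    push_cast
    rw [sq_abs, sq_abs]
    ring
  abs_h_le := by
    intro i j hi hj
    simp only [AddMonoidHom.mk'_apply]
    push_cast
    have key : ∀ a : ℤ, |a| ≤ |a| ^ 2 := fun a => by
      rcases eq_or_ne a 0 with rfl | h
      · simp
      · exact le_self_pow₀ (Int.one_le_abs h) two_ne_zero
    have hi' : (i : ℤ) ≤ R := by exact_mod_cast hi.le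
    have hj' : (j : ℤ) ≤ R := by exact_mod_cast hj.le
    calc |u.1 * j - u.2 * i| ≤ |u.1 * j| + |u.2 * i| := abs_sub _ _
      _ = |u.1| * j + |u.2| * i := by rw [abs_mul, abs_mul, Nat.abs_cast, Nat.abs_cast]
      _ ≤ |u.1| ^ 2 * R + |u.2| ^ 2 * R := by
          gcongr
          · exact key _
          · exact key _
      _ = R * (|u.1| ^ 2 + |u.2| ^ 2) := by ring
  right_mem := by
    refine ⟨R * u.1, -u.2, ?_⟩
    ext
    · simp
      ring
    · simp
      ring
  up_mem := by
    refine ⟨R * u.2, u.1, ?_⟩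
    ext
    · simp
      ring
    · simp
      ring
  cover := by
    intro w hw
    simp only [AddMonoidHom.mk'_apply] at hw
    push_cast at hw ⊢
    obtain ⟨p, q⟩ := u
    obtain ⟨x, y⟩ := w
    simp only [sq_abs] at hw ⊢
    have hD : 0 < p ^ 2 + q ^ 2 := by
      rcases eq_or_ne p 0 with rfl | h
      · have h₂ : q ≠ 0 := fun h₂ => hu (by simp [h₂])
        positivity
      · positivity
    obtain ⟨D, hDdef⟩ : ∃ D, D = p ^ 2 + q ^ 2 := ⟨_, rfl⟩
    rw [← hDdef] at hD hw
    -- Adding `t • u` reduces the inner product with `u` to `g` in `[0, D)`. Inner product and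
    -- determinant together recover the coordinates: `D` times them is `p * g - q * h` and `q * g +
    -- p * h`.
    obtain ⟨t, ht⟩ : ∃ t, t = -((p * x + q * y) / D) := ⟨_, rfl⟩
    have b₁ := Int.ediv_mul_le (p * x + q * y) hD.ne'
    have b₂ := Int.lt_ediv_add_one_mul_self (p * x + q * y) hD
    have e : (p * x + q * y) / D = -t := by rw [ht, neg_neg]
    rw [e] at b₁ b₂
    have hR' : (1 : ℤ) ≤ R := by exact_mod_cast hR
    obtain ⟨g, hg⟩ : ∃ g, g = p * x + q * y + t * D := ⟨_, rfl⟩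
    obtain ⟨h, hh⟩ : ∃ h, h = p * y - q * x := ⟨_, rfl⟩
    have hg₁ : |g| ≤ D := abs_le.2 ⟨by linarith, by linarith⟩
    rw [← hh] at hw
    have gR : |g| ≤ R * D := hg₁.trans (by nlinarith)
    refine ⟨t, ?_, ?_⟩
    · simp only [Prod.smul_mk, smul_eq_mul, Prod.mk_add_mk]
      refine le_of_mul_le_mul_left ?_ hD
      calc D * |x + t * p| = |D * (x + t * p)| := by rw [abs_mul, abs_of_pos hD]
        _ = |p * g - q * h| := by rw [hg, hh, hDdef]; ring_nf
        _ ≤ |p| * |g| + |q| * |h| := by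
            rw [← abs_mul, ← abs_mul]
            exact abs_sub _ _
        _ ≤ |p| * (R * D) + |q| * (R * D) := by gcongr
        _ = D * (R * (|p| + |q|)) := by ring
    · simp only [Prod.smul_mk, smul_eq_mul, Prod.mk_add_mk]
      refine le_of_mul_le_mul_left ?_ hD
      calc D * |y + t * q| = |D * (y + t * q)| := by rw [abs_mul, abs_of_pos hD]
        _ = |q * g + p * h| := by rw [hg, hh, hDdef]; ring_nf
        _ ≤ |q| * |g| + |p| * |h| := by
            rw [← abs_mul, ← abs_mul]
            exact abs_add_le _ _
        _ ≤ |q| * (R * D) + |p| * (R * D) := by gcongr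
        _ = D * (R * (|p| + |q|)) := by ring

/-! ### Identifying codes on the hexagonal grid as a local rule on cells. -/

lemma mem_pathBall_one {V : Type*} {G : SimpleGraph V} {u z : V} :
    z ∈ pathBall G 1 u ↔ z = u ∨ G.Adj u z := by
  constructor
  · rintro ⟨p, hp⟩
    cases p with
    | nil => exact Or.inl rfl
    | cons h q =>
      cases q with
      | nil => exact Or.inr h
      | cons h' q' => simp at hp
  · rintro (rfl | h)
    · exact ⟨SimpleGraph.Walk.nil, by simp⟩
    · exact ⟨SimpleGraph.Walk.cons h SimpleGraph.Walk.nil, by simp⟩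

lemma hexCoord_apply (w : ℤ × ℤ) : hexCoord w = (w.1, w.1 + 2 * w.2) := by
  ext
  · simp [hexCoord]
  · simp [hexCoord, mul_comm]

lemma hexCoord_add (w s : ℤ × ℤ) : hexCoord (w + s) = hexCoord w + hexCoord s := by
  simp only [hexCoord, Prod.fst_add, Prod.snd_add, add_smul]
  abel

lemma mem_hexLattice_iff {v : ℤ × ℤ} : v ∈ hexLattice ↔ ∃ w, hexCoord w = v := by
  rw [hexLattice, AddSubgroup.mem_closure_pair]
  exact ⟨fun ⟨a, b, h⟩ => ⟨(b, a), by rw [← h, hexCoord, add_comm]⟩,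
    fun ⟨w, h⟩ => ⟨w.2, w.1, by rw [← h, hexCoord, add_comm]⟩⟩

lemma exists_eq_hexCoord (z : ℤ × ℤ) : ∃ w, z = hexCoord w ∨ z = hexCoord w + (1, 0) := by
  obtain ⟨x, y⟩ := z
  rcases Int.even_or_odd (y - x) with ⟨k, hk⟩ | ⟨k, hk⟩
  · refine ⟨(x, k), Or.inl ?_⟩
    rw [hexCoord_apply]
    ext
    · rfl
    · simp only
      omega
  · refine ⟨(x - 1, k + 1), Or.inr ?_⟩
    rw [hexCoord_apply]
    ext
    · simp
    · simp only [Prod.mk_add_mk]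
      omega

lemma negOnePow_add_hexCoord (x y : ℤ) (w : ℤ × ℤ) :
    (x + (hexCoord w).1 + (y + (hexCoord w).2)).negOnePow = (x + y).negOnePow := by
  have : x + (hexCoord w).1 + (y + (hexCoord w).2) = (x + y) + 2 * (w.1 + w.2) := by
    rw [hexCoord_apply]
    ring
  rw [this, Int.negOnePow_add, Int.negOnePow_two_mul, mul_one]

lemma hexGrid_adj_add_iff (w u z : ℤ × ℤ) :
    hexGrid.Adj (u + hexCoord w) (z + hexCoord w) ↔ hexGrid.Adj u z := by
  obtain ⟨x, y⟩ := u
  obtain ⟨x', y'⟩ := z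
  simp only [hexGrid, SimpleGraph.fromRel_adj, ne_eq, add_left_inj, Prod.fst_add, Prod.snd_add,
    negOnePow_add_hexCoord, Prod.ext_iff]
  simp only [add_right_comm _ (hexCoord w).1, add_right_comm _ (hexCoord w).2, add_left_inj]

lemma mem_pathBall_hexGrid_add_iff (w u z : ℤ × ℤ) :
    z + hexCoord w ∈ pathBall hexGrid 1 (u + hexCoord w) ↔ z ∈ pathBall hexGrid 1 u := by
  rw [mem_pathBall_one, mem_pathBall_one, hexGrid_adj_add_iff, add_left_inj]

lemma abs_sub_le_of_mem_pathBall_hexGrid {u z : ℤ × ℤ} (h : z ∈ pathBall hexGrid 1 u) :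
    |z.1 - u.1| ≤ 1 ∧ |z.2 - u.2| ≤ 1 := by
  rw [mem_pathBall_one] at h
  rcases h with rfl | h
  · simp
  · simp only [hexGrid, SimpleGraph.fromRel_adj] at h
    rcases h with ⟨_, (rfl | rfl) | (rfl | rfl)⟩ <;>
      simp [Int.abs_negOnePow]

/-- The conditions on an identifying code `C` of radius one that concern the ball around `u`. -/
def IsIdentifiedAt (C : Set (ℤ × ℤ)) (u : ℤ × ℤ) : Prop :=
  (pathBall hexGrid 1 u ∩ C).Nonempty ∧
    ∀ v, u ≠ v → (pathBall hexGrid 1 u ∩ pathBall hexGrid 1 v).Nonempty →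
      pathBall hexGrid 1 u ∩ C ≠ pathBall hexGrid 1 v ∩ C

/-- Vertices with disjoint balls are separated as soon as their code sets are nonempty, so only
intersecting balls need comparing. -/
lemma isIdentifyingCode_iff {C : Set (ℤ × ℤ)} :
    IsIdentifyingCode hexGrid 1 C ↔ ∀ u, IsIdentifiedAt C u := by
  refine ⟨fun h u => ⟨h.1 u, fun v huv _ => h.2 u v huv⟩, fun h => ⟨fun u => (h u).1,
    fun u v huv heq => ?_⟩⟩
  obtain ⟨z, hz⟩ := (h u).1
  exact (h u).2 v huv ⟨z, hz.1, (heq ▸ hz).1⟩ heq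

/-- Centres of intersecting balls differ by at most 2 in each coordinate, and their balls reach one
further. -/
lemma IsIdentifiedAt.congr {C C' : Set (ℤ × ℤ)} {u : ℤ × ℤ}
    (h : ∀ z : ℤ × ℤ, |z.1 - u.1| ≤ 3 → |z.2 - u.2| ≤ 3 → (z ∈ C ↔ z ∈ C'))
    (hC : IsIdentifiedAt C u) : IsIdentifiedAt C' u := by
  have inter_eq : ∀ v : ℤ × ℤ, |v.1 - u.1| ≤ 2 → |v.2 - u.2| ≤ 2 →
      pathBall hexGrid 1 v ∩ C = pathBall hexGrid 1 v ∩ C' := by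
    intro v h₁ h₂
    ext z
    refine and_congr_right fun hz => ?_
    obtain ⟨h₃, h₄⟩ := abs_sub_le_of_mem_pathBall_hexGrid hz
    rw [abs_le] at *
    exact h z (by rw [abs_le]; omega) (by rw [abs_le]; omega)
  have hu := inter_eq u (by simp) (by simp)
  refine ⟨hu ▸ hC.1, fun v huv hne => ?_⟩
  obtain ⟨z, hz, hz'⟩ := hne
  obtain ⟨h₁, h₂⟩ := abs_sub_le_of_mem_pathBall_hexGrid hz
  obtain ⟨h₃, h₄⟩ := abs_sub_le_of_mem_pathBall_hexGrid hz'
  rw [abs_le] at h₁ h₂ h₃ h₄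
  rw [← hu, ← inter_eq v (by rw [abs_le]; omega) (by rw [abs_le]; omega)]
  exact hC.2 v huv ⟨z, hz, hz'⟩

lemma isIdentifiedAt_translate_iff {C : Set (ℤ × ℤ)} {u : ℤ × ℤ} (w : ℤ × ℤ) :
    IsIdentifiedAt {z | z + hexCoord w ∈ C} u ↔ IsIdentifiedAt C (u + hexCoord w) := by
  have pre : ∀ v, pathBall hexGrid 1 v ∩ {z | z + hexCoord w ∈ C} =
      (fun z => z + hexCoord w) ⁻¹' (pathBall hexGrid 1 (v + hexCoord w) ∩ C) := fun v => by
    ext z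
    simp [mem_pathBall_hexGrid_add_iff]
  have pre' : ∀ v, pathBall hexGrid 1 u ∩ pathBall hexGrid 1 v =
      (fun z => z + hexCoord w) ⁻¹'
        (pathBall hexGrid 1 (u + hexCoord w) ∩ pathBall hexGrid 1 (v + hexCoord w)) := fun v => by
    ext z
    simp [mem_pathBall_hexGrid_add_iff]
  have hs : Function.Surjective fun z : ℤ × ℤ => z + hexCoord w := add_right_surjective _
  simp only [IsIdentifiedAt, pre, pre', hs.nonempty_preimage, ne_eq, hs.preimage_injective.eq_iff]
  refine and_congr_right fun _ => ?_
  rw [hs.forall (p := fun v => ¬u + hexCoord w = v → _)]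
  simp

open Classical in
/-- The contents of the cell with index `w`. -/
noncomputable def cellPattern (C : Set (ℤ × ℤ)) (w : ℤ × ℤ) : Bool × Bool :=
  (decide (hexCoord w ∈ C), decide (hexCoord w + (1, 0) ∈ C))

lemma cellPattern_eq_iff {C C' : Set (ℤ × ℤ)} {w w' : ℤ × ℤ} :
    cellPattern C w = cellPattern C' w' ↔ (hexCoord w ∈ C ↔ hexCoord w' ∈ C') ∧
      (hexCoord w + (1, 0) ∈ C ↔ hexCoord w' + (1, 0) ∈ C') := by
  simp [cellPattern]

lemma cellPattern_translate (C : Set (ℤ × ℤ)) (w s : ℤ × ℤ) :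
    cellPattern {z | z + hexCoord w ∈ C} s = cellPattern C (w + s) := by
  rw [cellPattern_eq_iff, hexCoord_add, Set.mem_ofPred_eq, Set.mem_ofPred_eq, add_comm (hexCoord s),
    add_right_comm (hexCoord s), add_comm (hexCoord s)]
  exact ⟨Iff.rfl, Iff.rfl⟩

lemma exists_cellPattern_eq (c : ℤ × ℤ → Bool × Bool) : ∃ C, cellPattern C = c := by
  refine ⟨{z | ∃ w, z = hexCoord w ∧ (c w).1 = true ∨ z = hexCoord w + (1, 0) ∧ (c w).2 = true},
    funext fun w => ?_⟩
  have inj : ∀ a b, hexCoord a = hexCoord b ↔ a = b := fun a b => by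
    simp only [hexCoord_apply, Prod.ext_iff]
    omega
  have ne : ∀ a b, ¬hexCoord a = hexCoord b + (1, 0) := fun a b => by
    simp only [hexCoord_apply, Prod.ext_iff, Prod.mk_add_mk]
    omega
  have ne' : ∀ a b, ¬hexCoord a + (1, 0) = hexCoord b := fun a b h => ne b a h.symm
  simp [cellPattern, inj, ne, ne']

/-- The local rule for the cell contents of an identifying code: the conditions on the two vertices
of the central cell of the window hold. -/
def hexRule (p : Fin 11 → Fin 11 → Bool × Bool) : Prop :=
  ∃ C : Set (ℤ × ℤ), (∀ i j : Fin 11, cellPattern C ((i : ℤ), (j : ℤ)) = p i j) ∧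
    IsIdentifiedAt C (hexCoord (5, 5)) ∧ IsIdentifiedAt C (hexCoord (5, 5) + (1, 0))

/-- The rectangle contains everything within 3 of the two vertices `(5, 15)` and `(6, 15)` of the
central cell. The cells meeting it have indices inside the window, so the choice of `C` in `hexRule`
outside the window is immaterial. -/
lemma mem_iff_of_cellPattern_eq {C C' : Set (ℤ × ℤ)}
    (h : ∀ i j : Fin 11, cellPattern C ((i : ℤ), (j : ℤ)) = cellPattern C' ((i : ℤ), (j : ℤ)))
    {z : ℤ × ℤ} (h₁ : 2 ≤ z.1 ∧ z.1 ≤ 9) (h₂ : 12 ≤ z.2 ∧ z.2 ≤ 18) : z ∈ C ↔ z ∈ C' := by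
  have h' : ∀ w : ℤ × ℤ, 0 ≤ w.1 → w.1 < 11 → 0 ≤ w.2 → w.2 < 11 →
      cellPattern C w = cellPattern C' w := by
    rintro ⟨a, b⟩ ha ha' hb hb'
    lift a to ℕ using ha
    lift b to ℕ using hb
    exact h ⟨a, by simp only at ha'; omega⟩ ⟨b, by simp only at hb'; omega⟩
  obtain ⟨w, rfl | rfl⟩ := exists_eq_hexCoord z
  · rw [hexCoord_apply] at h₁ h₂
    exact (cellPattern_eq_iff.1 (h' w (by omega) (by omega) (by omega) (by omega))).1
  · rw [hexCoord_apply] at h₁ h₂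
    simp only [Prod.mk_add_mk] at h₁ h₂
    exact (cellPattern_eq_iff.1 (h' w (by omega) (by omega) (by omega) (by omega))).2

lemma isIdentifyingCode_iff_isAdmissible {C : Set (ℤ × ℤ)} :
    IsIdentifyingCode hexGrid 1 C ↔ IsAdmissible hexRule (cellPattern C) := by
  rw [isIdentifyingCode_iff]
  constructor
  · intro h w
    refine ⟨{z | z + hexCoord w ∈ C}, fun i j => cellPattern_translate C w _, ?_, ?_⟩
    · exact (isIdentifiedAt_translate_iff w).2 (h _)
    · exact (isIdentifiedAt_translate_iff w).2 (h _)
  · intro h u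
    obtain ⟨w, hw⟩ := exists_eq_hexCoord u
    obtain ⟨C', hp, h₁, h₂⟩ := h (w - (5, 5))
    have hp' : ∀ i j : Fin 11, cellPattern C' ((i : ℤ), (j : ℤ)) =
        cellPattern {z | z + hexCoord (w - (5, 5)) ∈ C} ((i : ℤ), (j : ℤ)) := fun i j => by
      rw [hp, cellPattern_translate]
    have e : hexCoord (5, 5) + hexCoord (w - (5, 5)) = hexCoord w := by
      rw [← hexCoord_add, add_sub_cancel]
    have h5 : hexCoord (5, 5) = (5, 15) := by
      rw [hexCoord_apply]
      norm_num
    rcases hw with rfl | rfl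
    · rw [← e, ← isIdentifiedAt_translate_iff]
      refine h₁.congr fun z hz₁ hz₂ => ?_
      rw [h5, abs_le] at hz₁ hz₂
      simp only at hz₁ hz₂
      exact mem_iff_of_cellPattern_eq hp' (by omega) (by omega)
    · rw [← e, add_right_comm, ← isIdentifiedAt_translate_iff]
      refine h₂.congr fun z hz₁ hz₂ => ?_
      rw [h5, abs_le] at hz₁ hz₂
      simp only [Prod.mk_add_mk] at hz₁ hz₂
      exact mem_iff_of_cellPattern_eq hp' (by omega) (by omega)

lemma isPeriodicCode_iff {C : Set (ℤ × ℤ)} {w : ℤ × ℤ} :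
    IsPeriodicCode (hexCoord w) C ↔ Function.Periodic (cellPattern C) w := by
  constructor
  · intro h s
    rw [cellPattern_eq_iff, hexCoord_add, add_right_comm, h, h]
    exact ⟨Iff.rfl, Iff.rfl⟩
  · intro h u
    obtain ⟨s, rfl | rfl⟩ := exists_eq_hexCoord u
    · rw [← hexCoord_add]
      exact (cellPattern_eq_iff.1 (h s)).1
    · rw [add_right_comm, ← hexCoord_add]
      exact (cellPattern_eq_iff.1 (h s)).2

/-- The number of codewords in a cell with contents `b`. -/
def cellWeight (b : Bool × Bool) : ℕ :=
  b.1.toNat + b.2.toNat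

lemma cellDensity_eq (C : Set (ℤ × ℤ)) (w : ℤ × ℤ) :
    cellDensity C w = (cellWeight (cellPattern C w) : ℝ) / 2 := by
  classical
  by_cases h₁ : hexCoord w ∈ C <;> by_cases h₂ : hexCoord w + (1, 0) ∈ C <;>
    simp [cellDensity, cellWeight, cellPattern, h₁, h₂]

lemma hasCodeDensity_iff {C : Set (ℤ × ℤ)} {δ : ℝ} :
    HasCodeDensity C δ ↔ HasAvg (fun w => (cellWeight (cellPattern C w) : ℝ)) (2 * δ) := by
  have e : ∀ n : ℕ, (∑ w ∈ Finset.Icc (-(n : ℤ)) n ×ˢ Finset.Icc (-(n : ℤ)) n, cellDensity C w) /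
      (2 * (n : ℝ) + 1) ^ 2 = boxAvg (fun w => (cellWeight (cellPattern C w) : ℝ)) n / 2 := by
    intro n
    simp only [cellDensity_eq, boxAvg, ← Finset.sum_div]
    rw [div_right_comm]
  simp only [HasCodeDensity, e, HasAvg]
  constructor
  · intro h
    simpa only [mul_div_cancel₀ _ (two_ne_zero' ℝ)] using h.const_mul 2
  · intro h
    simpa only [mul_div_cancel_left₀ _ (two_ne_zero' ℝ)] using h.div_const 2

lemma mem_periodicCodeDensities_iff {w : ℤ × ℤ} {δ : ℝ} :
    δ ∈ periodicCodeDensities (hexCoord w) ↔ ∃ c, IsAdmissible hexRule c ∧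
      Function.Periodic c w ∧ HasAvg (fun s => (cellWeight (c s) : ℝ)) (2 * δ) := by
  constructor
  · rintro ⟨C, h₁, h₂, h₃⟩
    exact ⟨cellPattern C, isIdentifyingCode_iff_isAdmissible.1 h₁, isPeriodicCode_iff.1 h₂,
      hasCodeDensity_iff.1 h₃⟩
  · rintro ⟨c, h₁, h₂, h₃⟩
    obtain ⟨C, rfl⟩ := exists_cellPattern_eq c
    exact ⟨C, isIdentifyingCode_iff_isAdmissible.2 h₁, isPeriodicCode_iff.2 h₂,
      hasCodeDensity_iff.2 h₃⟩

lemma hexGrid_adj_right (u : ℤ × ℤ) : hexGrid.Adj u (u.1 + 1, u.2) := by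
  obtain ⟨x, y⟩ := u
  simp [hexGrid]

lemma hexGrid_adj_left (u : ℤ × ℤ) : hexGrid.Adj u (u.1 - 1, u.2) := by
  simpa using (hexGrid_adj_right (u.1 - 1, u.2)).symm

lemma not_mem_pathBall_hexGrid_of_ne {u z : ℤ × ℤ} (h₁ : u.1 ≠ z.1) (h₂ : u.2 ≠ z.2) :
    z ∉ pathBall hexGrid 1 u := by
  rw [mem_pathBall_one]
  rintro (rfl | h)
  · exact h₁ rfl
  · simp only [hexGrid, SimpleGraph.fromRel_adj] at h
    rcases h with ⟨_, (rfl | rfl) | (rfl | rfl)⟩ <;> simp at h₁ h₂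

/-- The two horizontal neighbours fix the first coordinate of the centre, and a ball contains only
points sharing a coordinate with its centre. Hence the whole vertex set is an identifying code, so
admissible configurations exist for every period. -/
lemma pathBall_hexGrid_injective : Function.Injective (pathBall hexGrid 1) := by
  intro u v h
  have hr : (u.1 + 1, u.2) ∈ pathBall hexGrid 1 v :=
    h ▸ mem_pathBall_one.2 (Or.inr (hexGrid_adj_right u))
  have hl : (u.1 - 1, u.2) ∈ pathBall hexGrid 1 v :=
    h ▸ mem_pathBall_one.2 (Or.inr (hexGrid_adj_left u))
  have h₁ := abs_sub_le_of_mem_pathBall_hexGrid hr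
  have h₂ := abs_sub_le_of_mem_pathBall_hexGrid hl
  simp only [abs_le] at h₁ h₂
  have e₁ : v.1 = u.1 := by omega
  refine Prod.ext e₁.symm ?_
  by_contra hne
  exact not_mem_pathBall_hexGrid_of_ne (u := v) (z := (u.1 + 1, u.2)) (by simp only; omega)
    (by simp only; omega) hr

lemma isAdmissible_full : IsAdmissible hexRule fun _ => (true, true) := by
  have h : IsIdentifyingCode hexGrid 1 (Set.univ : Set (ℤ × ℤ)) := by
    refine ⟨fun u => ⟨u, mem_pathBall_one.2 (Or.inl rfl), trivial⟩, fun u v huv h => huv ?_⟩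
    simp only [Set.inter_univ] at h
    exact pathBall_hexGrid_injective h
  have e : cellPattern Set.univ = fun _ => (true, true) := by
    funext w
    simp [cellPattern]
  rw [← e]
  exact isIdentifyingCode_iff_isAdmissible.1 h

/-! ### Biperiodic configurations coded by natural numbers. -/

/-- The contents of a cell that are encoded by a digit in base four. -/
def toCell (n : ℕ) : Bool × Bool :=
  (decide (n % 2 = 1), decide (n / 2 % 2 = 1))

/-- The digit with coordinates `x`, `y` modulo `N` of the base-four expansion of `s`. -/
def torusDigit (N s x y : ℕ) : ℕ :=
  s / 4 ^ (x % N * N + y % N) % 4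

/-- The `N`-biperiodic configuration that is encoded by the base-four expansion of `s`. -/
def torusConfig (N s : ℕ) (w : ℤ × ℤ) : Bool × Bool :=
  toCell (torusDigit N s (w.1 % N).toNat (w.2 % N).toNat)

lemma torusConfig_natCast (N s x y : ℕ) :
    torusConfig N s ((x : ℤ), (y : ℤ)) = toCell (torusDigit N s x y) := by
  have e : ∀ z : ℕ, ((z : ℤ) % N).toNat = z % N := fun z => by
    rw [← Int.natCast_mod, Int.toNat_natCast]
  simp only [torusConfig, torusDigit, e, Nat.mod_mod]

lemma torusConfig_periodic_right (N s : ℕ) : Function.Periodic (torusConfig N s) ((N : ℤ), 0) := by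
  intro w
  simp [torusConfig]

lemma torusConfig_periodic_up (N s : ℕ) : Function.Periodic (torusConfig N s) (0, (N : ℤ)) := by
  intro w
  simp [torusConfig]

lemma eq_of_biperiodic {B : Type*} {f g : ℤ × ℤ → B} {N : ℕ} (hN : 0 < N)
    (f₁ : Function.Periodic f ((N : ℤ), 0)) (f₂ : Function.Periodic f (0, (N : ℤ)))
    (g₁ : Function.Periodic g ((N : ℤ), 0)) (g₂ : Function.Periodic g (0, (N : ℤ)))
    (h : ∀ x < N, ∀ y < N, f ((x : ℤ), (y : ℤ)) = g ((x : ℤ), (y : ℤ))) : f = g := by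
  have red : ∀ {e : ℤ × ℤ → B}, Function.Periodic e ((N : ℤ), 0) →
      Function.Periodic e (0, (N : ℤ)) → ∀ w : ℤ × ℤ, e w = e (w.1 % N, w.2 % N) := by
    intro e e₁ e₂ w
    rw [← (e₁.zsmul (w.1 / N)).add_period (e₂.zsmul (w.2 / N)) (w.1 % N, w.2 % N)]
    congr 1
    ext
    · simp [mul_comm, Int.emod_add_mul_ediv]
    · simp [mul_comm, Int.emod_add_mul_ediv]
  have hN' : (0 : ℤ) < N := by exact_mod_cast hN
  funext w
  rw [red f₁ f₂, red g₁ g₂]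
  have l₁ := Int.emod_lt_of_pos w.1 hN'
  have l₂ := Int.emod_lt_of_pos w.2 hN'
  have p₁ := Int.emod_nonneg w.1 hN'.ne'
  have p₂ := Int.emod_nonneg w.2 hN'.ne'
  generalize w.1 % (N : ℤ) = x at *
  generalize w.2 % (N : ℤ) = y at *
  lift x to ℕ using p₁
  lift y to ℕ using p₂
  exact h x (by exact_mod_cast l₁) y (by exact_mod_cast l₂)

lemma exists_base_four_digits (n : ℕ) : ∀ d : ℕ → ℕ, (∀ i, d i < 4) →
    ∃ s < 4 ^ n, ∀ i < n, s / 4 ^ i % 4 = d i := by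
  induction n with
  | zero => exact fun d _ => ⟨0, by simp, by simp⟩
  | succ n ih =>
    intro d hd
    obtain ⟨s, hs, h⟩ := ih (fun i => d (i + 1)) fun i => hd _
    have h0 := hd 0
    refine ⟨d 0 + 4 * s, by rw [pow_succ]; omega, fun i hi => ?_⟩
    rcases i with _ | i
    · simp only [pow_zero, Nat.div_one]
      omega
    · rw [pow_succ', ← Nat.div_div_eq_div_mul, ← h i (by omega)]
      congr 2
      omega

lemma exists_torusConfig_eq {c : ℤ × ℤ → Bool × Bool} {N : ℕ} (hN : 0 < N)
    (h₁ : Function.Periodic c ((N : ℤ), 0)) (h₂ : Function.Periodic c (0, (N : ℤ))) :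
    ∃ s < 4 ^ (N * N), torusConfig N s = c := by
  have inv : ∀ b : Bool × Bool, ∃ d < 4, toCell d = b := by decide
  choose e he hte using inv
  obtain ⟨s, hs, h⟩ := exists_base_four_digits (N * N)
    (fun i => e (c (((i / N : ℕ) : ℤ), ((i % N : ℕ) : ℤ)))) fun i => he _
  refine ⟨s, hs, eq_of_biperiodic hN (torusConfig_periodic_right N s) (torusConfig_periodic_up N s)
    h₁ h₂ fun x hx y hy => ?_⟩
  have hi : x * N + y < N * N := by nlinarith
  rw [torusConfig_natCast, torusDigit, Nat.mod_eq_of_lt hx, Nat.mod_eq_of_lt hy, h _ hi, hte]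
  have a₁ : (x * N + y) / N = x := by
    rw [mul_comm, Nat.mul_add_div hN, Nat.div_eq_of_lt hy, add_zero]
  have a₂ : (x * N + y) % N = y := by
    rw [mul_comm, Nat.mul_add_mod, Nat.mod_eq_of_lt hy]
  rw [a₁, a₂]

/-- The number of codewords in one fundamental square of `torusConfig N s`. -/
def torusWeight (N s : ℕ) : ℕ :=
  ∑ x ∈ Finset.range N, ∑ y ∈ Finset.range N, cellWeight (toCell (torusDigit N s x y))

lemma hasAvg_torusConfig {N : ℕ} (hN : 0 < N) (s : ℕ) :
    HasAvg (fun w => (cellWeight (torusConfig N s w) : ℝ)) ((torusWeight N s : ℝ) / (N * N)) := by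
  have h := hasAvg_of_biperiodic (g := fun w => (cellWeight (torusConfig N s w) : ℝ))
    (StripFrame.exists_abs_comp_le (fun b => (cellWeight b : ℝ)) _) hN
    ((torusConfig_periodic_right N s).comp fun b => (cellWeight b : ℝ))
    ((torusConfig_periodic_up N s).comp fun b => (cellWeight b : ℝ))
  simp only [torusConfig_natCast, squareIndices, Finset.sum_product] at h
  simpa only [torusWeight, Nat.cast_sum, Nat.cast_mul] using h

/-- The cell index `w` with `hexCoord w = v`, each coordinate being given as a difference of two
natural numbers. -/
def splitCoord (v : ℤ × ℤ) : (ℕ × ℕ) × ℕ × ℕ :=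
  ((v.1.toNat, (-v.1).toNat),
    ((v.2.toNat + (-v.1).toNat) - ((-v.2).toNat + v.1.toNat)) / 2,
    (((-v.2).toNat + v.1.toNat) - (v.2.toNat + (-v.1).toNat)) / 2)

/-- `d` represents the pair of integers `w` by truncated differences. -/
def IsSplit (d : (ℕ × ℕ) × ℕ × ℕ) (w : ℤ × ℤ) : Prop :=
  (w.1 = d.1.1 - d.1.2 ∧ w.1.natAbs = d.1.1 + d.1.2) ∧
    (w.2 = d.2.1 - d.2.2 ∧ w.2.natAbs = d.2.1 + d.2.2)

/-- If `v = hexCoord w`, then `w.2` is half of `v.2 - v.1`; truncated subtraction in both orders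
yields its positive and negative parts. -/
lemma isSplit_splitCoord (w : ℤ × ℤ) : IsSplit (splitCoord (hexCoord w)) w := by
  simp only [IsSplit, splitCoord, hexCoord_apply]
  omega

/-- The number `t`, read as a pair `(N, s)`, encodes an admissible configuration that is periodic
under the vector represented by `d`. -/
def IsTorusSolution (t : ℕ) (d : (ℕ × ℕ) × ℕ × ℕ) : Prop :=
  0 < t.unpair.1 ∧ ∀ x < t.unpair.1, ∀ y < t.unpair.1,
    torusDigit t.unpair.1 t.unpair.2 (x + d.1.1) (y + d.2.1) =
      torusDigit t.unpair.1 t.unpair.2 (x + d.1.2) (y + d.2.2) ∧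
    hexRule fun i j => toCell (torusDigit t.unpair.1 t.unpair.2 (x + i) (y + j))

lemma toCell_torusDigit_eq_iff {N s x y x' y' : ℕ} :
    toCell (torusDigit N s x y) = toCell (torusDigit N s x' y') ↔
      torusDigit N s x y = torusDigit N s x' y' := by
  have inj : ∀ a < 4, ∀ b < 4, toCell a = toCell b → a = b := by decide
  exact ⟨inj _ (Nat.mod_lt _ (by norm_num)) _ (Nat.mod_lt _ (by norm_num)), fun h => by rw [h]⟩

/-- Both conditions are themselves `N`-biperiodic in the position, so one fundamental square
suffices. Periodicity is read as equality of two translates with nonnegative offsets. -/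
lemma isTorusSolution_iff {t : ℕ} {d : (ℕ × ℕ) × ℕ × ℕ} {w : ℤ × ℤ} (hd : IsSplit d w) :
    IsTorusSolution t d ↔ 0 < t.unpair.1 ∧
      IsAdmissible hexRule (torusConfig t.unpair.1 t.unpair.2) ∧
        Function.Periodic (torusConfig t.unpair.1 t.unpair.2) w := by
  obtain ⟨N, s, rfl⟩ : ∃ N s, t = Nat.pair N s := ⟨_, _, (Nat.pair_unpair t).symm⟩
  obtain ⟨⟨p, p'⟩, q, q'⟩ := d
  obtain ⟨⟨hp, -⟩, hq, -⟩ := hd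
  simp only at hp hq
  simp only [IsTorusSolution, Nat.unpair_pair]
  set c := torusConfig N s
  have c₁ : Function.Periodic c ((N : ℤ), 0) := torusConfig_periodic_right N s
  have c₂ : Function.Periodic c (0, (N : ℤ)) := torusConfig_periodic_up N s
  have cN : ∀ x y : ℕ, toCell (torusDigit N s x y) = c ((x : ℤ), (y : ℤ)) := fun x y =>
    (torusConfig_natCast N s x y).symm
  simp only [← toCell_torusDigit_eq_iff, cN]
  have shift : ∀ z : ℤ × ℤ, Function.Periodic (fun w => c (w + z)) ((N : ℤ), 0) ∧
      Function.Periodic (fun w => c (w + z)) (0, (N : ℤ)) := fun z =>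
    ⟨fun w => by simp only [add_right_comm w _ z, c₁ _],
      fun w => by simp only [add_right_comm w _ z, c₂ _]⟩
  refine and_congr_right fun hN => ?_
  have per : Function.Periodic c w ↔ ∀ x < N, ∀ y < N,
      c (((x + p : ℕ) : ℤ), ((y + q : ℕ) : ℤ)) = c (((x + p' : ℕ) : ℤ), ((y + q' : ℕ) : ℤ)) := by
    have e : Function.Periodic c w ↔
        (fun z => c (z + ((p : ℤ), (q : ℤ)))) = fun z => c (z + ((p' : ℤ), (q' : ℤ))) := by
      have hw : ((p : ℤ), (q : ℤ)) = ((p' : ℤ), (q' : ℤ)) + w := by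
        ext
        · simp [hp]
        · simp [hq]
      constructor
      · intro h
        funext z
        rw [hw, ← add_assoc, h]
      · intro h z
        have := congrFun h (z - ((p' : ℤ), (q' : ℤ)))
        simp only [sub_add_cancel] at this
        rw [← this, hw, ← add_assoc, sub_add_cancel]
    rw [e]
    constructor
    · intro h x _ y _
      simpa using congrFun h ((x : ℤ), (y : ℤ))
    · intro h
      refine eq_of_biperiodic hN (shift _).1 (shift _).2 (shift _).1 (shift _).2
        fun x hx y hy => ?_
      simpa using h x hx y hy
  have adm : IsAdmissible hexRule c ↔ ∀ x < N, ∀ y < N,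
      hexRule fun i j => c (((x + i : ℕ) : ℤ), ((y + j : ℕ) : ℤ)) := by
    constructor
    · intro h x _ y _
      simpa using h ((x : ℤ), (y : ℤ))
    · intro h
      have heq : (fun z : ℤ × ℤ => hexRule fun i j => c (z + ((i : ℤ), (j : ℤ)))) =
          fun _ => True := by
        refine eq_of_biperiodic hN ?_ ?_ (fun _ => rfl) (fun _ => rfl) fun x hx y hy => ?_
        · intro z
          simp only [add_right_comm z ((N : ℤ), (0 : ℤ)), c₁ _]
        · intro z
          simp only [add_right_comm z ((0 : ℤ), (N : ℤ)), c₂ _]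
        · simpa using h x hx y hy
      exact fun z => of_eq_true (congrFun heq z)
  rw [per, adm]
  exact ⟨fun h => ⟨fun x hx y hy => (h x hx y hy).2, fun x hx y hy => (h x hx y hy).1⟩,
    fun h x hx y hy => ⟨h.2 x hx y hy, h.1 x hx y hy⟩⟩

/-- A bound for the side of the square periods of optimal configurations. -/
def periodBound (d : (ℕ × ℕ) × ℕ × ℕ) : ℕ :=
  4 ^ ((2 * (11 * (d.1.1 + d.1.2 + (d.2.1 + d.2.2))) + 1) *
      (2 * (11 * (d.1.1 + d.1.2 + (d.2.1 + d.2.2))) + 1)) *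
    (11 * ((d.1.1 + d.1.2) ^ 2 + (d.2.1 + d.2.2) ^ 2))

/-- A bound for the numbers that encode configurations whose period is at most `periodBound d`. -/
def codeBound (d : (ℕ × ℕ) × ℕ × ℕ) : ℕ :=
  Nat.pair (periodBound d) (4 ^ (periodBound d * periodBound d))

/-- The number `t` encodes a configuration of least density among those that are periodic under the
vector represented by `d`. -/
def IsOptimalCode (d : (ℕ × ℕ) × ℕ × ℕ) (t : ℕ) : Prop :=
  IsTorusSolution t d ∧ ∀ t' < codeBound d, IsTorusSolution t' d →
    torusWeight t.unpair.1 t.unpair.2 * (t'.unpair.1 * t'.unpair.1) ≤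
      torusWeight t'.unpair.1 t'.unpair.2 * (t.unpair.1 * t.unpair.1)

/-- The average weight of the configuration that is encoded by `t`. -/
noncomputable def codeAverage (t : ℕ) : ℝ :=
  (torusWeight t.unpair.1 t.unpair.2 : ℝ) / (t.unpair.1 * t.unpair.1)

lemma codeAverage_le_iff {t t' : ℕ} (ht : 0 < t.unpair.1) (ht' : 0 < t'.unpair.1) :
    codeAverage t ≤ codeAverage t' ↔
      torusWeight t.unpair.1 t.unpair.2 * (t'.unpair.1 * t'.unpair.1) ≤
        torusWeight t'.unpair.1 t'.unpair.2 * (t.unpair.1 * t.unpair.1) := by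
  have h : (0 : ℝ) < t.unpair.1 := by exact_mod_cast ht
  have h' : (0 : ℝ) < t'.unpair.1 := by exact_mod_cast ht'
  rw [codeAverage, codeAverage, div_le_div_iff₀ (by positivity) (by positivity)]
  exact_mod_cast Iff.rfl

lemma exists_isOptimalCode {d : (ℕ × ℕ) × ℕ × ℕ} {w : ℤ × ℤ} (hd : IsSplit d w) :
    ∃ t, IsOptimalCode d t := by
  classical
  -- Side 1 with the single digit 3 codes the full cell everywhere. The search range below is
  -- enlarged to contain this code, so a minimum exists.
  have full : IsTorusSolution (Nat.pair 1 3) d := by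
    rw [isTorusSolution_iff hd, Nat.unpair_pair]
    have e : torusConfig 1 3 = fun _ => (true, true) := by
      funext w
      simp [torusConfig, torusDigit, toCell]
    simp only [e]
    exact ⟨one_pos, isAdmissible_full, fun _ => rfl⟩
  obtain ⟨t, ht, hmin⟩ := Finset.exists_min_image
    ((Finset.range (codeBound d + Nat.pair 1 3 + 1)).filter fun t => IsTorusSolution t d)
    codeAverage ⟨Nat.pair 1 3, by simpa using full⟩
  simp only [Finset.mem_filter, Finset.mem_range] at ht hmin
  exact ⟨t, ht.2, fun t' hlt ht' =>
    (codeAverage_le_iff ht.2.1 ht'.1).1 (hmin t' ⟨by omega, ht'⟩)⟩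

lemma IsOptimalCode.isLeast {d : (ℕ × ℕ) × ℕ × ℕ} {w : ℤ × ℤ} (hd : IsSplit d w) (hw : w ≠ 0)
    {t : ℕ} (ht : IsOptimalCode d t) :
    IsLeast (periodicCodeDensities (hexCoord w)) (codeAverage t / 2) := by
  obtain ⟨hsol, hmin⟩ := ht
  have hsol' := (isTorusSolution_iff hd).1 hsol
  refine ⟨mem_periodicCodeDensities_iff.2 ⟨_, hsol'.2.1, hsol'.2.2, ?_⟩, fun δ hδ => ?_⟩
  · rw [mul_div_cancel₀ _ (two_ne_zero' ℝ)]
    exact hasAvg_torusConfig hsol'.1 _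
  · obtain ⟨c, hadm, hper, havg⟩ := mem_periodicCodeDensities_iff.1 hδ
    rw [div_le_iff₀ two_pos, mul_comm δ]
    refine (stripFrame w hw 11 (by norm_num)).le_of_hasAvg (wt := fun b => (cellWeight b : ℝ))
      (B := periodBound d) ?_ ?_ (by unfold codeAverage; positivity) (fun b => Nat.cast_nonneg _)
      hadm hper havg
    -- `periodBound d` is `patchCount` times the strip height, for four letters and `R = 11`.
    · obtain ⟨⟨-, h₁⟩, -, h₂⟩ := hd
      simp only [StripFrame.patchCount, stripFrame, h₁, h₂, periodBound]
      exact le_of_eq rfl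
    · intro c' hc' hu' N hN hNB hr hup δ' hδ'
      obtain ⟨s, hs, rfl⟩ := exists_torusConfig_eq hN hr hup
      have hsol₂ : IsTorusSolution (Nat.pair N s) d := by
        rw [isTorusSolution_iff hd, Nat.unpair_pair]
        exact ⟨hN, hc', hu'⟩
      have hlt : Nat.pair N s < codeBound d := by
        refine (Nat.pair_lt_pair_right N (hs.trans_le (Nat.pow_le_pow_right (by norm_num)
          (Nat.mul_le_mul hNB hNB)))).trans_le ?_
        rcases hNB.eq_or_lt with h | h
        · rw [h, codeBound]
        · exact (Nat.pair_lt_pair_left _ h).le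
      have hle := (codeAverage_le_iff hsol.1 hsol₂.1).2 (hmin _ hlt hsol₂)
      refine hle.trans_eq ?_
      rw [codeAverage, Nat.unpair_pair]
      exact tendsto_nhds_unique (hasAvg_torusConfig hN s) hδ'

/-! ### Computability of the search for an optimal code. -/

lemma primrecPred_forall_lt {β : Type*} [Primcodable β] {f : β → ℕ} (hf : Primrec f)
    {P : ℕ → β → Prop} (hP : PrimrecRel P) : PrimrecPred fun b => ∀ x < f b, P x b := by
  refine (hP.forall_mem_list.comp (Primrec.list_range.comp hf) Primrec.id).of_eq fun b => ?_
  simp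

lemma primrec_sum_range {β : Type*} [Primcodable β] {f : β → ℕ} (hf : Primrec f)
    {g : β → ℕ → ℕ} (hg : Primrec₂ g) : Primrec fun b => ∑ x ∈ Finset.range (f b), g b x := by
  have h : Primrec₂ fun (b : β) (p : ℕ × ℕ) => p.2 + g b p.1 :=
    Primrec.nat_add.comp (Primrec.snd.comp Primrec.snd)
      (hg.comp Primrec.fst (Primrec.fst.comp Primrec.snd))
  refine (Primrec.nat_rec' hf (Primrec.const 0) h).of_eq fun b => ?_
  induction f b with
  | zero => rfl
  | succ n ih => rw [Finset.sum_range_succ, ← ih]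

lemma primrec_nat_pow : Primrec₂ ((· ^ ·) : ℕ → ℕ → ℕ) :=
  Primrec₂.unpaired'.1 Nat.Primrec.pow

lemma encode_int_natCast (n : ℕ) : Encodable.encode (n : ℤ) = 2 * n := rfl

lemma encode_int_negSucc (n : ℕ) : Encodable.encode (Int.negSucc n) = 2 * n + 1 := rfl

lemma primrec_int_natCast : Primrec fun n : ℕ => (n : ℤ) := by
  rw [← Primrec.encode_iff]
  exact Primrec.nat_mul.comp (Primrec.const 2) Primrec.id

lemma primrec_int_toNat : Primrec Int.toNat := by
  have h : Primrec fun z : ℤ =>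
      if Encodable.encode z % 2 = 0 then Encodable.encode z / 2 else 0 :=
    Primrec.ite (Primrec.eq.comp (Primrec.nat_mod.comp Primrec.encode (Primrec.const 2))
      (Primrec.const 0)) (Primrec.nat_div.comp Primrec.encode (Primrec.const 2)) (Primrec.const 0)
  refine h.of_eq fun z => ?_
  rcases z with n | n
  · rw [Int.ofNat_eq_natCast, encode_int_natCast]
    simp
  · rw [encode_int_negSucc, if_neg (by omega)]
    rfl

lemma primrec_int_neg_toNat : Primrec fun z : ℤ => (-z).toNat := by
  have h : Primrec fun z : ℤ =>
      if Encodable.encode z % 2 = 0 then 0 else Encodable.encode z / 2 + 1 :=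
    Primrec.ite (Primrec.eq.comp (Primrec.nat_mod.comp Primrec.encode (Primrec.const 2))
      (Primrec.const 0)) (Primrec.const 0)
      (Primrec.succ.comp (Primrec.nat_div.comp Primrec.encode (Primrec.const 2)))
  refine h.of_eq fun z => ?_
  rcases z with n | n
  · rw [Int.ofNat_eq_natCast, encode_int_natCast]
    simp
  · rw [encode_int_negSucc, if_neg (by omega), Int.neg_negSucc]
    omega

lemma primrec_splitCoord : Primrec splitCoord := by
  have a₁ := primrec_int_toNat.comp (Primrec.fst (α := ℤ) (β := ℤ))
  have a₂ := primrec_int_neg_toNat.comp (Primrec.fst (α := ℤ) (β := ℤ))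
  have b₁ := primrec_int_toNat.comp (Primrec.snd (α := ℤ) (β := ℤ))
  have b₂ := primrec_int_neg_toNat.comp (Primrec.snd (α := ℤ) (β := ℤ))
  have s₁ := Primrec.nat_add.comp b₁ a₂
  have s₂ := Primrec.nat_add.comp b₂ a₁
  exact (a₁.pair a₂).pair ((Primrec.nat_div.comp (Primrec.nat_sub.comp s₁ s₂)
    (Primrec.const 2)).pair (Primrec.nat_div.comp (Primrec.nat_sub.comp s₂ s₁) (Primrec.const 2)))

lemma primrec_torusDigit {β : Type*} [Primcodable β] {N s x y : β → ℕ} (hN : Primrec N)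
    (hs : Primrec s) (hx : Primrec x) (hy : Primrec y) :
    Primrec fun b => torusDigit (N b) (s b) (x b) (y b) :=
  Primrec.nat_mod.comp (Primrec.nat_div.comp hs (primrec_nat_pow.comp (Primrec.const 4)
    (Primrec.nat_add.comp (Primrec.nat_mul.comp (Primrec.nat_mod.comp hx hN) hN)
      (Primrec.nat_mod.comp hy hN)))) (Primrec.const 4)

lemma primrec_toCell_torusDigit {β : Type*} [Primcodable β] {N s x y : β → ℕ} (hN : Primrec N)
    (hs : Primrec s) (hx : Primrec x) (hy : Primrec y) :
    Primrec fun b => toCell (torusDigit (N b) (s b) (x b) (y b)) := by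
  have h : Primrec fun b =>
      (⟨torusDigit (N b) (s b) (x b) (y b), Nat.mod_lt _ (by norm_num)⟩ : Fin 4) :=
    Primrec.fin_val_iff.1 (primrec_torusDigit hN hs hx hy)
  exact (Primrec.dom_finite fun i : Fin 4 => toCell i).comp h

lemma primrec_torusWeight : Primrec fun t : ℕ => torusWeight t.unpair.1 t.unpair.2 := by
  have hN : Primrec fun t : ℕ => t.unpair.1 := Primrec.fst.comp Primrec.unpair
  have hs : Primrec fun t : ℕ => t.unpair.2 := Primrec.snd.comp Primrec.unpair
  refine primrec_sum_range hN (primrec_sum_range (hN.comp Primrec.fst) ?_)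
  have h₁ : Primrec fun b : (ℕ × ℕ) × ℕ => b.1.1 := Primrec.fst.comp Primrec.fst
  exact (Primrec.dom_finite cellWeight).comp (primrec_toCell_torusDigit (hN.comp h₁) (hs.comp h₁)
    (Primrec.snd.comp Primrec.fst) Primrec.snd)

lemma primrecRel_isTorusSolution : PrimrecRel IsTorusSolution := by
  have hN : Primrec fun b : ℕ × ((ℕ × ℕ) × ℕ × ℕ) => b.1.unpair.1 :=
    Primrec.fst.comp (Primrec.unpair.comp Primrec.fst)
  have hs : Primrec fun b : ℕ × ((ℕ × ℕ) × ℕ × ℕ) => b.1.unpair.2 :=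
    Primrec.snd.comp (Primrec.unpair.comp Primrec.fst)
  refine PrimrecPred.and (Primrec.nat_lt.comp (Primrec.const 0) hN)
    (primrecPred_forall_lt hN (primrecPred_forall_lt (hN.comp Primrec.snd) ?_))
  have y₀ : Primrec fun b : ℕ × (ℕ × (ℕ × ((ℕ × ℕ) × ℕ × ℕ))) => b.1 := Primrec.fst
  have x₀ : Primrec fun b : ℕ × (ℕ × (ℕ × ((ℕ × ℕ) × ℕ × ℕ))) => b.2.1 :=
    Primrec.fst.comp Primrec.snd
  have z₀ : Primrec fun b : ℕ × (ℕ × (ℕ × ((ℕ × ℕ) × ℕ × ℕ))) => b.2.2 :=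
    Primrec.snd.comp Primrec.snd
  have d₀ := (Primrec.snd (α := ℕ) (β := (ℕ × ℕ) × ℕ × ℕ)).comp z₀
  have p := Primrec.fst.comp d₀
  have q := Primrec.snd.comp d₀
  have N₀ := hN.comp z₀
  have s₀ := hs.comp z₀
  refine PrimrecPred.and (Primrec.eq.comp
    (primrec_torusDigit N₀ s₀ (Primrec.nat_add.comp x₀ (Primrec.fst.comp p))
      (Primrec.nat_add.comp y₀ (Primrec.fst.comp q)))
    (primrec_torusDigit N₀ s₀ (Primrec.nat_add.comp x₀ (Primrec.snd.comp p))
      (Primrec.nat_add.comp y₀ (Primrec.snd.comp q)))) ?_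
  -- The windows form a finite type, so any predicate on them is primitive recursive, even one
  -- defined by an existential over infinite sets.
  have hrule : PrimrecPred hexRule := by
    classical
    exact (Primrec.dom_finite fun r => decide (hexRule r)).primrecPred
  refine hrule.comp (Primrec.fin_curry.2 (Primrec.fin_curry.2 ?_))
  have w₀ : Primrec fun b : ((ℕ × (ℕ × (ℕ × ((ℕ × ℕ) × ℕ × ℕ)))) × Fin 11) × Fin 11 => b.1.1 :=
    Primrec.fst.comp Primrec.fst
  exact primrec_toCell_torusDigit (N₀.comp w₀) (s₀.comp w₀)
    (Primrec.nat_add.comp (x₀.comp w₀) (Primrec.fin_val.comp (Primrec.snd.comp Primrec.fst)))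
    (Primrec.nat_add.comp (y₀.comp w₀) (Primrec.fin_val.comp Primrec.snd))

lemma primrec_codeBound : Primrec codeBound := by
  have p : Primrec fun d : (ℕ × ℕ) × ℕ × ℕ => d.1.1 + d.1.2 :=
    Primrec.nat_add.comp (Primrec.fst.comp Primrec.fst) (Primrec.snd.comp Primrec.fst)
  have q : Primrec fun d : (ℕ × ℕ) × ℕ × ℕ => d.2.1 + d.2.2 :=
    Primrec.nat_add.comp (Primrec.fst.comp Primrec.snd) (Primrec.snd.comp Primrec.snd)
  have m := Primrec.succ.comp (Primrec.nat_mul.comp (Primrec.const 2)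
    (Primrec.nat_mul.comp (Primrec.const 11) (Primrec.nat_add.comp p q)))
  have b : Primrec periodBound :=
    Primrec.nat_mul.comp (primrec_nat_pow.comp (Primrec.const 4) (Primrec.nat_mul.comp m m))
      (Primrec.nat_mul.comp (Primrec.const 11)
        (Primrec.nat_add.comp (primrec_nat_pow.comp p (Primrec.const 2))
          (primrec_nat_pow.comp q (Primrec.const 2))))
  exact Primrec₂.natPair.comp b (primrec_nat_pow.comp (Primrec.const 4) (Primrec.nat_mul.comp b b))

lemma primrecRel_isOptimalCode : PrimrecRel IsOptimalCode := by
  have d₀ := Primrec.fst (α := (ℕ × ℕ) × ℕ × ℕ) (β := ℕ)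
  have t₀ := Primrec.snd (α := (ℕ × ℕ) × ℕ × ℕ) (β := ℕ)
  refine PrimrecPred.and (primrecRel_isTorusSolution.comp t₀ d₀)
    (primrecPred_forall_lt (primrec_codeBound.comp d₀) ?_)
  have t' := Primrec.fst (α := ℕ) (β := ((ℕ × ℕ) × ℕ × ℕ) × ℕ)
  have b := Primrec.snd (α := ℕ) (β := ((ℕ × ℕ) × ℕ × ℕ) × ℕ)
  have t := t₀.comp b
  have hN : Primrec fun t : ℕ => t.unpair.1 * t.unpair.1 :=
    Primrec.nat_mul.comp (Primrec.fst.comp Primrec.unpair) (Primrec.fst.comp Primrec.unpair)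
  have h := PrimrecPred.or (primrecRel_isTorusSolution.comp t' (d₀.comp b)).not
    (Primrec.nat_le.comp (Primrec.nat_mul.comp (primrec_torusWeight.comp t) (hN.comp t'))
      (Primrec.nat_mul.comp (primrec_torusWeight.comp t') (hN.comp t)))
  exact h.of_eq fun _ => imp_iff_not_or.symm

/-- Unbounded search halts wherever a witness exists; no bound on the witness is needed. -/
lemma exists_partrec_search {α σ : Type*} [Primcodable α] [Primcodable σ] {P : α → ℕ → Prop}
    (hP : PrimrecRel P) {out : ℕ → σ} (hout : Primrec out) :
    ∃ f : α →. σ, Partrec f ∧ ∀ a, (∃ n, P a n) → ∃ n, out n ∈ f a ∧ P a n := by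
  classical
  have h : Computable₂ fun a n => decide (P a n) := hP.decide.to_comp
  refine ⟨fun a => (Nat.rfind fun n => Part.some (decide (P a n))).map out,
    (Partrec.rfind h.partrec₂).map (hout.to_comp.comp Computable.snd).to₂, fun a ⟨n, hn⟩ => ?_⟩
  obtain ⟨m, hm, -⟩ := Nat.rfind_min' (p := fun n => decide (P a n)) (m := n) (by simpa using hn)
  exact ⟨m, Part.mem_map _ hm, by simpa using Nat.rfind_spec hm⟩

theorem lemma5 :
    (∀ v : ℤ × ℤ, v ∈ hexLattice → v ≠ 0 →
      IsLeast (periodicCodeDensities v) (minPeriodicDensity v)) ∧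
    ExactlyComputableOn {v : ℤ × ℤ | v ∈ hexLattice ∧ v ≠ 0} minPeriodicDensity := by
  have key : ∀ v ∈ hexLattice, v ≠ 0 → (∃ t, IsOptimalCode (splitCoord v) t) ∧
      ∀ t, IsOptimalCode (splitCoord v) t →
        IsLeast (periodicCodeDensities v) (codeAverage t / 2) := by
    intro v hv hv₀
    obtain ⟨w, rfl⟩ := mem_hexLattice_iff.1 hv
    have hw : w ≠ 0 := by
      rintro rfl
      exact hv₀ (by simp [hexCoord])
    exact ⟨exists_isOptimalCode (isSplit_splitCoord w),
      fun t ht => ht.isLeast (isSplit_splitCoord w) hw⟩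
  refine ⟨fun v hv hv₀ => ?_, ?_⟩
  · obtain ⟨⟨t, ht⟩, h⟩ := key v hv hv₀
    rw [minPeriodicDensity, (h t ht).csInf_eq]
    exact h t ht
  -- The denominator has a factor 2 because each cell holds two vertices.
  · have hout : Primrec fun t : ℕ => (((torusWeight t.unpair.1 t.unpair.2 : ℕ) : ℤ),
        2 * (t.unpair.1 * t.unpair.1)) :=
      (primrec_int_natCast.comp primrec_torusWeight).pair
        (Primrec.nat_mul.comp (Primrec.const 2)
          (Primrec.nat_mul.comp (Primrec.fst.comp Primrec.unpair)
            (Primrec.fst.comp Primrec.unpair)))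
    obtain ⟨f, hf, hspec⟩ := exists_partrec_search
      (P := fun v t => IsOptimalCode (splitCoord v) t)
      (primrecRel_isOptimalCode.comp (primrec_splitCoord.comp Primrec.fst) Primrec.snd) hout
    refine ⟨f, hf, fun v hv => ?_⟩
    obtain ⟨hex, h⟩ := key v hv.1 hv.2
    obtain ⟨t, htf, ht⟩ := hspec v hex
    refine ⟨(torusWeight t.unpair.1 t.unpair.2 : ℕ), 2 * (t.unpair.1 * t.unpair.1), htf, ?_, ?_⟩
    · have := ht.1.1
      positivity
    · rw [minPeriodicDensity, (h t ht).csInf_eq, codeAverage, div_div]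
      push_cast
      rw [mul_comm (2 : ℝ)]
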